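/- **Setting.** Let $N\ge 1$, $p>1$, $0<\alpha<1$, and consider the time-fractional Cauchy problem $$\partial_t^\alpha u-\Delta u=u^p \ \text{ in } (0,T)\times\mathbf R^N,\qquad u(0)=\mu, \tag{P}$$ where $\partial_t^\alpha$ is the Caputo derivative and $\mu$ is a nonnegative Radon measure (a nonnegative locally integrable function $f$ is identified with $f\,dx$). Put $G(t,x)=(4\pi t)^{-N/2}e^{-|x|^2/(4t)}$, $e^{t\Delta}\mu(x)=\int G(t,x-y)\,d\mu(y)$, and let $h_\alpha$ be the probability density on $(0,\infty)$ with $\int_0^\infty h_\alpha(\theta)e^{z\theta}d\theta=E_{\alpha,1}(z)=\sum_{k\ge0} z^k/\Gamma(\alpha k+1)$, i.e. $$h_\alpha(\theta)=\sum_{n\ge 0}\frac{(-\theta)^n}{n!\,\Gamma(1-\alpha-\alpha n)}=\frac{\theta^{\frac{\alpha}{1-\alpha}}}{\pi(1-\alpha)}\int_0^\pi A(\varphi)e^{-A(\varphi)\theta^{1/(1-\alpha)}}d\varphi,\qquad A(\varphi)=\frac{\sin(\alpha\varphi)^{\frac{\alpha}{1-\alpha}}\sin((1-\alpha)\varphi)}{(\sin\varphi)^{\frac1{1-\alpha}}}.$$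 Set $P_\alpha(t)=\int_0^\infty h_\alpha(\theta)e^{t^\alpha\theta\Delta}d\theta$ and $S_\alpha(t)=\int_0^\infty\theta h_\alpha(\theta)e^{t^\alpha\theta\Delta}d\theta$. A solution of (P) in $[0,T]\times\mathbf R^N$ is a nonnegative measurable $u$ with $$\infty>u(t,x)=[P_\alpha(t)\mu](x)+\alpha\int_0^t(t-s)^{\alpha-1}[S_\alpha(t-s)u(s)^p](x)\,ds\quad\text{for a.a. } t\in(0,T],\ x\in\mathbf R^N.$$ It is minimal if it is a.e. bounded above by every solution in $[0,T]\times\mathbf R^N$. The life span $T_\alpha[\mu]\in[0,\infty]$ is the supremum of all $T>0$ such that the minimal solution exists in $[0,T]\times\mathbf R^N$; a global-in-time solution is a function that is a solution in $[0,T]\times\mathbf R^N$ for every $T>0$. For quantities depending on $\alpha\in(0,1)$ and on a parameter $x$, $A\simeq B$ means that there are $c(\alpha),C(\alpha)>0$ independent of $x$ with $cB\le A\le CB$ for all $x$ and $\limsup_{\alpha\to1-0}c(\alpha),\ \limsup_{\alpha\to1-0}C(\alpha)\in(0,\infty)$. Let $\omega_N$ be the volume of the unit ball of $\mathbf R^N$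 and, for $j\in\{1,2,\dots\}$, $$r_j=(j\omega_N)^{-1/N},\qquad \psi_j=j\,\chi_{B(0,r_j)}.$$ **Theorem.** Let $p>p_F:=1+2/N$. (i) For each $\alpha\in(0,1)$ and each $j\ge1$ there is $\kappa_2(j)=\kappa_2(\alpha,j)\in(0,\infty)$ such that (P) with $\mu=\kappa\psi_j$ possesses a global-in-time solution if $0<\kappa<\kappa_2(j)$ and possesses no global-in-time solution if $\kappa>\kappa_2(j)$. Moreover, over all $j\ge1$, $$\kappa_2(j)\simeq j^{\frac{2}{N(p-1)}-1}.$$ (ii) For each $\alpha\in(0,1)$ there is $C>0$ such that for all $\kappa>0$ and all $j\ge1$ $$\min\{T_\alpha[\kappa\psi_j]^{\alpha/2},\,r_j\}\le C(\kappa j)^{-\frac{p-1}{2}}.$$ In particular $\lim_{j\to\infty}T_\alpha[\kappa\psi_j]=0$ for all $\alpha\in(0,1)$ and $\kappa>0$. Moreover there are $j_0(\alpha,\kappa)$ such that, over all $\kappa>0$ and $j\ge j_0(\alpha,\kappa)$, $$T_\alpha[\kappa\psi_j]\simeq(\kappa j)^{-\frac{p-1}{\alpha}},$$ with constants in $\simeq$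 that do not depend on $\kappa$ and $j$. -/

import Mathlib

open Set Filter Topology MeasureTheory
open scoped ENNReal

noncomputable section

namespace FracFujita

/-- Euclidean space `ℝ^N`. -/
abbrev Space (N : ℕ) : Type := EuclideanSpace ℝ (Fin N)

/-- The Fujita exponent `p_F = 1 + 2 / N`. -/
def fujitaExponent (N : ℕ) : ℝ := 1 + 2 / (N : ℝ)

/-- The heat kernel `G(t,x) = (4πt)^{-N/2} exp(-|x|²/(4t))`. -/
def heatKernel (N : ℕ) (t : ℝ) (x : Space N) : ℝ :=
  (4 * Real.pi * t) ^ (-((N : ℝ) / 2)) * Real.exp (-(‖x‖ ^ 2) / (4 * t))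

/-- `e^{tΔ} μ (x) = ∫ G(t, x - y) dμ(y)`, for a nonnegative measure `μ`. -/
def heat {N : ℕ} (t : ℝ) (μ : Measure (Space N)) (x : Space N) : ℝ≥0∞ :=
  ∫⁻ y, ENNReal.ofReal (heatKernel N t (x - y)) ∂μ

/-- Zolotarev's function
`A_α(φ) = sin(αφ)^{α/(1-α)} sin((1-α)φ) / sin(φ)^{1/(1-α)}` on `(0,π)`. -/
def zolotarev (α φ : ℝ) : ℝ :=
  Real.sin (α * φ) ^ (α / (1 - α)) * Real.sin ((1 - α) * φ) / Real.sin φ ^ (1 / (1 - α))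

/-- The density `h_α` on `(0,∞)` whose Laplace transform is the Mittag-Leffler function,
`∫₀^∞ h_α(θ) e^{zθ} dθ = E_{α,1}(z)`. It is the M-Wright (Mainardi) function
`∑ₙ (-θ)^n / (n! Γ(1 - α - α n))`, that is, the density of `X^{-α}` where `X` is the one-sided
`α`-stable variable with `E[e^{-sX}] = e^{-s^α}`. It is written here in the Zolotarev-Kanter
integral form (`X = (A_α(U)/W)^{(1-α)/α}` with `U` uniform on `(0,π)` and `W` standard
exponential, independent):
`h_α(θ) = θ^{α/(1-α)} / (π (1-α)) * ∫₀^π A_α(φ) exp(-A_α(φ) θ^{1/(1-α)}) dφ`. -/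
def mittagDensity (α θ : ℝ) : ℝ≥0∞ :=
  ENNReal.ofReal (θ ^ (α / (1 - α)) / (Real.pi * (1 - α))) *
    ∫⁻ φ in Ioo 0 Real.pi,
      ENNReal.ofReal (zolotarev α φ * Real.exp (-(zolotarev α φ * θ ^ (1 / (1 - α)))))

/-- `P_α(t) μ = ∫₀^∞ h_α(θ) e^{t^α θ Δ} μ dθ`. -/
def opP {N : ℕ} (α t : ℝ) (μ : Measure (Space N)) (x : Space N) : ℝ≥0∞ :=
  ∫⁻ θ in Ioi 0, mittagDensity α θ * heat (t ^ α * θ) μ x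

/-- `S_α(t) μ = ∫₀^∞ θ h_α(θ) e^{t^α θ Δ} μ dθ`. -/
def opS {N : ℕ} (α t : ℝ) (μ : Measure (Space N)) (x : Space N) : ℝ≥0∞ :=
  ∫⁻ θ in Ioi 0, ENNReal.ofReal θ * mittagDensity α θ * heat (t ^ α * θ) μ x

/-- The right-hand side of the integral equation,
`P_α(t)μ + α ∫₀^t (t-s)^{α-1} S_α(t-s) u(s)^p ds`; the function `u(s)^p` is identified with
the measure `u(s)^p dx`. -/
def duhamel {N : ℕ} (α p : ℝ) (μ : Measure (Space N)) (u : ℝ → Space N → ℝ≥0∞)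
    (t : ℝ) (x : Space N) : ℝ≥0∞ :=
  opP α t μ x + ENNReal.ofReal α *
    ∫⁻ s in Ioo 0 t, ENNReal.ofReal ((t - s) ^ (α - 1)) *
      opS α (t - s) (volume.withDensity fun y => u s y ^ p) x

/-- Lebesgue measure on `(0,T] × ℝ^N`. -/
def slab (N : ℕ) (T : ℝ) : Measure (ℝ × Space N) :=
  ((volume : Measure ℝ).restrict (Ioc 0 T)).prod volume

/-- `u` is a nonnegative solution of `∂_t^α u - Δu = u^p`, `u(0) = μ`, in `[0,T] × ℝ^N`:
it is measurable and `∞ > u = (right-hand side)` almost everywhere in `(0,T] × ℝ^N`.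
The values of `u` outside `(0,T]` play no role. -/
def IsSolution {N : ℕ} (α p : ℝ) (μ : Measure (Space N)) (T : ℝ)
    (u : ℝ → Space N → ℝ≥0∞) : Prop :=
  Measurable (Function.uncurry u) ∧
    ∀ᵐ z ∂(slab N T), u z.1 z.2 < ∞ ∧ u z.1 z.2 = duhamel α p μ u z.1 z.2

/-- The minimal solution in `[0,T] × ℝ^N`: it lies below every other solution a.e. -/
def IsMinimalSolution {N : ℕ} (α p : ℝ) (μ : Measure (Space N)) (T : ℝ)
    (u : ℝ → Space N → ℝ≥0∞) : Prop :=
  IsSolution α p μ T u ∧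
    ∀ v : ℝ → Space N → ℝ≥0∞, IsSolution α p μ T v →
      ∀ᵐ z ∂(slab N T), u z.1 z.2 ≤ v z.1 z.2

/-- The life span `T_α[μ] ∈ [0,∞]`: the supremum of all `T > 0` for which the minimal solution
exists in `[0,T] × ℝ^N`. -/
def lifespan {N : ℕ} (α p : ℝ) (μ : Measure (Space N)) : ℝ≥0∞ :=
  sSup {τ : ℝ≥0∞ | ∃ T : ℝ, 0 < T ∧ τ = ENNReal.ofReal T ∧
    ∃ u : ℝ → Space N → ℝ≥0∞, IsMinimalSolution α p μ T u}

/-- Existence of a global-in-time solution: one function solving the problem in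
`[0,T] × ℝ^N` for every `T > 0`. -/
def HasGlobalSolution {N : ℕ} (α p : ℝ) (μ : Measure (Space N)) : Prop :=
  ∃ u : ℝ → Space N → ℝ≥0∞, ∀ T : ℝ, 0 < T → IsSolution α p μ T u

/-- `ω_N`, the volume of the unit ball of `ℝ^N`. -/
def unitBallVolume (N : ℕ) : ℝ := (volume (Metric.ball (0 : Space N) 1)).toReal

/-- `r_j = (j ω_N)^{-1/N}`. -/
def radius (N j : ℕ) : ℝ := ((j : ℝ) * unitBallVolume N) ^ (-(1 / (N : ℝ)))

/-- `ψ_j = j χ_{B(0,r_j)}`. -/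
def psi (N j : ℕ) (x : Space N) : ℝ :=
  (Metric.ball (0 : Space N) (radius N j)).indicator (fun _ => (j : ℝ)) x

/-- The initial datum `κ ψ_j`, as the measure `κ ψ_j dx`. -/
def datum (N : ℕ) (κ : ℝ) (j : ℕ) : Measure (Space N) :=
  volume.withDensity fun x => ENNReal.ofReal (κ * psi N j x)

/-- The relation `A ≃ B`, for quantities depending on `α ∈ (0,1)` and a parameter `x`, with `x`
ranging over `D α`: there are `0 < c(α), C(α)`, independent of `x`, such that
`c B ≤ A ≤ C B`, and the upper limits of `c` and `C` as `α → 1-0` lie in `(0,∞)`. -/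
def SimeqOn {ι : Type*} (D : ℝ → Set ι) (A B : ℝ → ι → ℝ≥0∞) : Prop :=
  ∃ c C : ℝ → ℝ,
    (∀ α ∈ Ioo (0 : ℝ) 1, 0 < c α ∧ 0 < C α ∧ ∀ x ∈ D α,
      ENNReal.ofReal (c α) * B α x ≤ A α x ∧ A α x ≤ ENNReal.ofReal (C α) * B α x) ∧
    limsup (fun α => ENNReal.ofReal (c α)) (𝓝[<] (1 : ℝ)) ∈ Ioo (0 : ℝ≥0∞) ∞ ∧
    limsup (fun α => ENNReal.ofReal (C α)) (𝓝[<] (1 : ℝ)) ∈ Ioo (0 : ℝ≥0∞) ∞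

end FracFujita

end

/-!
The Picard iterates of the integral equation increase, and their limit is the minimal solution
wherever it is finite, so existence on `(0, T]` means that the limit is finite a.e. and nonexistence
means that it is not. Kanter's integral form of `h_α` bounds the moments that are needed from both
sides by constants that stay bounded as `α → 1`.

* Global existence: if `‖f‖_q` is small for `q = N (p - 1) / 2`, then `L^q`-`L^r` smoothing
  propagates an estimate `‖u(t)‖_r ≤ M t^{-β}` through the iterates. For `κ ψ_j` the norm is
  `κ j^{1 - 1/q}`.
* Nonexistence: if `f ≥ A` on a ball of radius `r` and the limit is finite up to time `T`, then the
  heat kernel keeps a fixed fraction of any lower bound on the ball up to diffusive time `r²`, and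
  the source term multiplies the bound by a fixed factor on each of a sequence of time intervals of
  geometrically decreasing length. The levels cannot blow up before `T`, hence
  `min (T^α) (r²) * A^(p-1) ≤ C`.
* Life span from below: a datum bounded by `A` keeps the iterates below `2 A` up to a time
  comparable to `A^{-(p-1)/α}`.
-/

namespace FracFujita

variable {N : ℕ}

/-! ### Measurability and monotonicity of the integral equation -/

lemma measurable_heatKernel : Measurable (Function.uncurry (heatKernel N)) := by
  unfold heatKernel Function.uncurry
  fun_prop

lemma measurable_heatKernel_sub (t : ℝ) (x : Space N) :
    Measurable fun y => ENNReal.ofReal (heatKernel N t (x - y)) :=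
  (measurable_heatKernel.comp
    (measurable_const.prodMk (measurable_const.sub measurable_id))).ennreal_ofReal

lemma heat_withDensity (t : ℝ) {f : Space N → ℝ≥0∞} (hf : Measurable f) (x : Space N) :
    heat t (volume.withDensity f) x =
      ∫⁻ y, ENNReal.ofReal (heatKernel N t (x - y)) * f y := by
  rw [heat, lintegral_withDensity_eq_lintegral_mul _ hf (measurable_heatKernel_sub t x)]
  simp [mul_comm]

lemma measurable_heat (μ : Measure (Space N)) [SFinite μ] :
    Measurable fun z : ℝ × Space N => heat z.1 μ z.2 :=
  Measurable.lintegral_prod_right' (f := fun w : (ℝ × Space N) × Space N =>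
      ENNReal.ofReal (heatKernel N w.1.1 (w.1.2 - w.2)))
    (measurable_heatKernel.comp (f := fun w : (ℝ × Space N) × Space N =>
      (w.1.1, w.1.2 - w.2)) (by fun_prop)).ennreal_ofReal

lemma measurable_heat_withDensity {f : ℝ → Space N → ℝ≥0∞}
    (hf : Measurable (Function.uncurry f)) :
    Measurable fun z : ℝ × ℝ × Space N => heat z.1 (volume.withDensity (f z.2.1)) z.2.2 := by
  have measurable_slice (s : ℝ) : Measurable (f s) := hf.comp measurable_prodMk_left
  simp_rw [fun z : ℝ × ℝ × Space N => heat_withDensity z.1 (measurable_slice z.2.1) z.2.2]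
  refine Measurable.lintegral_prod_right' (f := fun w : (ℝ × ℝ × Space N) × Space N =>
    ENNReal.ofReal (heatKernel N w.1.1 (w.1.2.2 - w.2)) * f w.1.2.1 w.2) (Measurable.mul ?_ ?_)
  · exact (measurable_heatKernel.comp (f := fun w : (ℝ × ℝ × Space N) × Space N =>
      (w.1.1, w.1.2.2 - w.2)) (by fun_prop)).ennreal_ofReal
  · exact hf.comp (f := fun w : (ℝ × ℝ × Space N) × Space N => (w.1.2.1, w.2)) (by fun_prop)

lemma measurable_zolotarev (α : ℝ) : Measurable (zolotarev α) := by
  unfold zolotarev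
  fun_prop

lemma measurable_mittagDensity (α : ℝ) : Measurable (mittagDensity α) := by
  have hA := measurable_zolotarev α
  refine Measurable.mul (by fun_prop) (Measurable.lintegral_prod_right' (f := fun w : ℝ × ℝ =>
    ENNReal.ofReal (zolotarev α w.2 * Real.exp (-(zolotarev α w.2 * w.1 ^ (1 / (1 - α)))))) ?_)
  fun_prop

lemma measurable_opP (α : ℝ) (μ : Measure (Space N)) [SFinite μ] :
    Measurable fun z : ℝ × Space N => opP α z.1 μ z.2 :=
  Measurable.lintegral_prod_right' (f := fun w : (ℝ × Space N) × ℝ =>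
      mittagDensity α w.2 * heat (w.1.1 ^ α * w.2) μ w.1.2)
    (((measurable_mittagDensity α).comp measurable_snd).mul
      ((measurable_heat μ).comp (f := fun w : (ℝ × Space N) × ℝ =>
        (w.1.1 ^ α * w.2, w.1.2)) (by fun_prop)))

lemma measurable_opS_withDensity (α : ℝ) {f : ℝ → Space N → ℝ≥0∞}
    (hf : Measurable (Function.uncurry f)) :
    Measurable fun z : ℝ × ℝ × Space N => opS α z.1 (volume.withDensity (f z.2.1)) z.2.2 :=
  Measurable.lintegral_prod_right' (f := fun w : (ℝ × ℝ × Space N) × ℝ =>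
      ENNReal.ofReal w.2 * mittagDensity α w.2 *
        heat (w.1.1 ^ α * w.2) (volume.withDensity (f w.1.2.1)) w.1.2.2)
    ((measurable_snd.ennreal_ofReal.mul ((measurable_mittagDensity α).comp measurable_snd)).mul
      ((measurable_heat_withDensity hf).comp (f := fun w : (ℝ × ℝ × Space N) × ℝ =>
        (w.1.1 ^ α * w.2, w.1.2.1, w.1.2.2)) (by fun_prop)))

lemma measurable_duhamel (α p : ℝ) (μ : Measure (Space N)) [SFinite μ]
    {u : ℝ → Space N → ℝ≥0∞} (hu : Measurable (Function.uncurry u)) :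
    Measurable (Function.uncurry (duhamel α p μ u)) := by
  -- The domain `0 < s < t` of the Duhamel integral depends on `t`: move it into an indicator.
  have duhamel_eq : Function.uncurry (duhamel α p μ u) = fun z : ℝ × Space N =>
      opP α z.1 μ z.2 + ENNReal.ofReal α * ∫⁻ s, {w : (ℝ × Space N) × ℝ |
        0 < w.2 ∧ w.2 < w.1.1}.indicator (fun w => ENNReal.ofReal ((w.1.1 - w.2) ^ (α - 1)) *
          opS α (w.1.1 - w.2) (volume.withDensity fun y => u w.2 y ^ p) w.1.2) (z, s) := by
    funext z
    simp only [Function.uncurry, duhamel]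
    rw [← lintegral_indicator measurableSet_Ioo]
    rfl
  rw [duhamel_eq]
  have hup : Measurable (Function.uncurry fun (s : ℝ) (y : Space N) => u s y ^ p) :=
    hu.pow_const p
  refine (measurable_opP α μ).add (Measurable.const_mul ?_ _)
  refine Measurable.lintegral_prod_right' (Measurable.indicator ?_ ?_)
  · exact Measurable.mul (by fun_prop) ((measurable_opS_withDensity α hup).comp
      (f := fun w : (ℝ × Space N) × ℝ => (w.1.1 - w.2, w.2, w.1.2)) (by fun_prop))
  · exact (measurableSet_lt measurable_const measurable_snd).inter
      (measurableSet_lt measurable_snd measurable_fst.fst)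

lemma heat_mono (t : ℝ) {μ ν : Measure (Space N)} (h : μ ≤ ν) (x : Space N) :
    heat t μ x ≤ heat t ν x :=
  lintegral_mono' h le_rfl

lemma opP_mono (α t : ℝ) {μ ν : Measure (Space N)} (h : μ ≤ ν) (x : Space N) :
    opP α t μ x ≤ opP α t ν x :=
  lintegral_mono fun _ => mul_le_mul_right (heat_mono _ h x) _

lemma opS_mono (α t : ℝ) {μ ν : Measure (Space N)} (h : μ ≤ ν) (x : Space N) :
    opS α t μ x ≤ opS α t ν x :=
  lintegral_mono fun _ => mul_le_mul_right (heat_mono _ h x) _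

lemma duhamel_mono {α p : ℝ} (hp : 0 ≤ p) {μ ν : Measure (Space N)} (hμ : μ ≤ ν)
    {u v : ℝ → Space N → ℝ≥0∞} {t : ℝ}
    (h : ∀ᵐ s ∂(volume.restrict (Ioo 0 t)), ∀ᵐ y, u s y ≤ v s y) (x : Space N) :
    duhamel α p μ u t x ≤ duhamel α p ν v t x := by
  refine add_le_add (opP_mono α t hμ x) (mul_le_mul_right (lintegral_mono_ae ?_) _)
  filter_upwards [h] with s hs
  refine mul_le_mul_right (opS_mono _ _ (withDensity_mono ?_) x) _
  filter_upwards [hs] with y hy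
  exact ENNReal.rpow_le_rpow hy hp

lemma heat_withDensity_iSup (t : ℝ) {f : ℕ → Space N → ℝ≥0∞} (hf : ∀ n, Measurable (f n))
    (hm : Monotone f) (x : Space N) :
    heat t (volume.withDensity fun y => ⨆ n, f n y) x =
      ⨆ n, heat t (volume.withDensity (f n)) x := by
  rw [heat_withDensity t (Measurable.iSup hf)]
  simp_rw [fun n => heat_withDensity t (hf n) x, ENNReal.mul_iSup]
  exact lintegral_iSup (fun n => (measurable_heatKernel_sub t x).mul (hf n))
    fun m n h y => mul_le_mul_right (hm h y) _

lemma opS_withDensity_iSup (α t : ℝ) {f : ℕ → Space N → ℝ≥0∞} (hf : ∀ n, Measurable (f n))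
    (hm : Monotone f) (x : Space N) :
    opS α t (volume.withDensity fun y => ⨆ n, f n y) x =
      ⨆ n, opS α t (volume.withDensity (f n)) x := by
  unfold opS
  simp_rw [heat_withDensity_iSup _ hf hm, ENNReal.mul_iSup]
  refine lintegral_iSup (fun n => ?_) ?_
  · exact (ENNReal.measurable_ofReal.mul (measurable_mittagDensity α)).mul
      ((measurable_heat _).comp (f := fun θ : ℝ => (t ^ α * θ, x)) (by fun_prop))
  · exact fun m n h θ =>
      mul_le_mul_right (heat_mono _ (withDensity_mono (ae_of_all _ (hm h))) x) _

lemma duhamel_iSup (α : ℝ) {p : ℝ} (hp : 0 < p) (μ : Measure (Space N))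
    {u : ℕ → ℝ → Space N → ℝ≥0∞} (hu : ∀ n, Measurable (Function.uncurry (u n)))
    (hm : ∀ t x, Monotone fun n => u n t x) (t : ℝ) (x : Space N) :
    duhamel α p μ (fun s y => ⨆ n, u n s y) t x = ⨆ n, duhamel α p μ (u n) t x := by
  have pow_iSup (s : ℝ) (y : Space N) : (⨆ n, u n s y) ^ p = ⨆ n, u n s y ^ p :=
    (ENNReal.orderIsoRpow p hp).map_iSup _
  have pow_mono (s : ℝ) : Monotone fun n y => u n s y ^ p := fun m n h y =>
    ENNReal.rpow_le_rpow (hm s y h) hp.le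
  have pow_meas (n : ℕ) : Measurable (Function.uncurry fun s y => u n s y ^ p) :=
    (hu n).pow_const p
  unfold duhamel
  simp_rw [pow_iSup, fun s => opS_withDensity_iSup α (t - s) (f := fun n y => u n s y ^ p)
    (fun n => (pow_meas n).comp measurable_prodMk_left) (pow_mono s) x, ENNReal.mul_iSup]
  rw [lintegral_iSup, ENNReal.mul_iSup, ENNReal.add_iSup]
  · exact fun n => Measurable.mul (by fun_prop) ((measurable_opS_withDensity α (pow_meas n)).comp
      (f := fun s : ℝ => (t - s, s, x)) (by fun_prop))
  · exact fun m n h s =>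
      mul_le_mul_right (opS_mono _ _ (withDensity_mono (ae_of_all _ (pow_mono s h))) x) _

/-! ### The minimal solution -/

/-- The Picard iterates of the integral equation, started from `0`. -/
noncomputable def picard (α p : ℝ) (μ : Measure (Space N)) : ℕ → ℝ → Space N → ℝ≥0∞
  | 0 => fun _ _ => 0
  | n + 1 => duhamel α p μ (picard α p μ n)

/-- The supremum of the Picard iterates: a fixed point of the integral equation which lies below
every solution. It is a solution exactly where it is finite. -/
noncomputable def picardLimit (α p : ℝ) (μ : Measure (Space N)) (t : ℝ) (x : Space N) : ℝ≥0∞ :=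
  ⨆ n, picard α p μ n t x

lemma measurable_picard (α p : ℝ) (μ : Measure (Space N)) [SFinite μ] (n : ℕ) :
    Measurable (Function.uncurry (picard α p μ n)) := by
  induction n with
  | zero => exact measurable_const
  | succ n ih => exact measurable_duhamel α p μ ih

lemma measurable_picardLimit (α p : ℝ) (μ : Measure (Space N)) [SFinite μ] :
    Measurable (Function.uncurry (picardLimit α p μ)) :=
  Measurable.iSup fun n => measurable_picard α p μ n

lemma picard_le_succ {p : ℝ} (hp : 0 ≤ p) (α : ℝ) (μ : Measure (Space N)) (n : ℕ) (t : ℝ)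
    (x : Space N) : picard α p μ n t x ≤ picard α p μ (n + 1) t x := by
  induction n generalizing t x with
  | zero => exact zero_le
  | succ n ih => exact duhamel_mono hp le_rfl (ae_of_all _ fun s => ae_of_all _ fun y => ih s y) x

lemma monotone_picard {p : ℝ} (hp : 0 ≤ p) (α : ℝ) (μ : Measure (Space N)) (t : ℝ)
    (x : Space N) : Monotone fun n => picard α p μ n t x :=
  monotone_nat_of_le_succ fun n => picard_le_succ hp α μ n t x

lemma picard_mono_measure {p : ℝ} (hp : 0 ≤ p) (α : ℝ) {μ ν : Measure (Space N)} (h : μ ≤ ν)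
    (n : ℕ) (t : ℝ) (x : Space N) : picard α p μ n t x ≤ picard α p ν n t x := by
  induction n generalizing t x with
  | zero => exact le_rfl
  | succ n ih => exact duhamel_mono hp h (ae_of_all _ fun s => ae_of_all _ fun y => ih s y) x

lemma picardLimit_mono_measure {p : ℝ} (hp : 0 ≤ p) (α : ℝ) {μ ν : Measure (Space N)}
    (h : μ ≤ ν) (t : ℝ) (x : Space N) : picardLimit α p μ t x ≤ picardLimit α p ν t x :=
  iSup_mono fun n => picard_mono_measure hp α h n t x

lemma duhamel_picardLimit (α : ℝ) {p : ℝ} (hp : 0 < p) (μ : Measure (Space N)) [SFinite μ]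
    (t : ℝ) (x : Space N) :
    duhamel α p μ (picardLimit α p μ) t x = picardLimit α p μ t x :=
  (duhamel_iSup α hp μ (measurable_picard α p μ) (monotone_picard hp.le α μ) t x).trans
    ((monotone_picard hp.le α μ t x).iSup_nat_add 1)

lemma ae_slab_mem_Ioc (T : ℝ) : ∀ᵐ z ∂(slab N T), z.1 ∈ Ioc 0 T :=
  Measure.quasiMeasurePreserving_fst.ae (ae_restrict_mem measurableSet_Ioc)

lemma slab_mono {S T : ℝ} (h : S ≤ T) : slab N S ≤ slab N T :=
  Measure.prod_mono (Measure.restrict_mono (Ioc_subset_Ioc_right h) le_rfl) le_rfl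

lemma picard_le_of_isSolution {α p : ℝ} (hp : 0 ≤ p) {μ : Measure (Space N)} {T : ℝ}
    {v : ℝ → Space N → ℝ≥0∞} (hv : IsSolution α p μ T v) (n : ℕ) :
    ∀ᵐ z ∂(slab N T), picard α p μ n z.1 z.2 ≤ v z.1 z.2 := by
  induction n with
  | zero => exact ae_of_all _ fun z => zero_le
  | succ n ih =>
    filter_upwards [hv.2, ae_slab_mem_Ioc T] with z hz hzT
    rw [hz.2]
    have Ioo_subset : Ioo 0 z.1 ⊆ Ioc 0 T := fun s hs => ⟨hs.1, hs.2.le.trans hzT.2⟩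
    exact duhamel_mono hp le_rfl
      (ae_restrict_of_ae_restrict_of_subset Ioo_subset (Measure.ae_ae_of_ae_prod ih)) z.2

lemma picardLimit_le_of_isSolution {α p : ℝ} (hp : 0 ≤ p) {μ : Measure (Space N)} {T : ℝ}
    {v : ℝ → Space N → ℝ≥0∞} (hv : IsSolution α p μ T v) :
    ∀ᵐ z ∂(slab N T), picardLimit α p μ z.1 z.2 ≤ v z.1 z.2 := by
  filter_upwards [ae_all_iff.2 (picard_le_of_isSolution hp hv)] with z hz
  exact iSup_le hz

lemma picardLimit_lt_top_of_isSolution {α p : ℝ} (hp : 0 ≤ p) {μ : Measure (Space N)} {T : ℝ}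
    {v : ℝ → Space N → ℝ≥0∞} (hv : IsSolution α p μ T v) :
    ∀ᵐ z ∂(slab N T), picardLimit α p μ z.1 z.2 < ∞ := by
  filter_upwards [picardLimit_le_of_isSolution hp hv, hv.2] with z hle hz
  exact hle.trans_lt hz.1

lemma isSolution_picardLimit {α p : ℝ} (hp : 0 < p) {μ : Measure (Space N)} [SFinite μ] {T : ℝ}
    (h : ∀ᵐ z ∂(slab N T), picardLimit α p μ z.1 z.2 < ∞) :
    IsSolution α p μ T (picardLimit α p μ) := by
  refine ⟨measurable_picardLimit α p μ, ?_⟩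
  filter_upwards [h] with z hz
  exact ⟨hz, (duhamel_picardLimit α hp μ z.1 z.2).symm⟩

lemma isMinimalSolution_picardLimit {α p : ℝ} (hp : 0 < p) {μ : Measure (Space N)} [SFinite μ]
    {T : ℝ} (h : ∀ᵐ z ∂(slab N T), picardLimit α p μ z.1 z.2 < ∞) :
    IsMinimalSolution α p μ T (picardLimit α p μ) :=
  ⟨isSolution_picardLimit hp h, fun _ hv => picardLimit_le_of_isSolution hp.le hv⟩

lemma hasGlobalSolution_iff_picardLimit_lt_top {α p : ℝ} (hp : 0 < p) {μ : Measure (Space N)}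
    [SFinite μ] :
    HasGlobalSolution α p μ ↔
      ∀ T : ℝ, 0 < T → ∀ᵐ z ∂(slab N T), picardLimit α p μ z.1 z.2 < ∞ :=
  ⟨fun ⟨_, hu⟩ T hT => picardLimit_lt_top_of_isSolution hp.le (hu T hT),
    fun h => ⟨_, fun T hT => isSolution_picardLimit hp (h T hT)⟩⟩

lemma HasGlobalSolution.mono {α p : ℝ} (hp : 0 < p) {μ ν : Measure (Space N)} [SFinite μ]
    [SFinite ν] (h : μ ≤ ν) (hν : HasGlobalSolution α p ν) : HasGlobalSolution α p μ := by
  rw [hasGlobalSolution_iff_picardLimit_lt_top hp] at hν ⊢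
  intro T hT
  filter_upwards [hν T hT] with z hz
  exact (picardLimit_mono_measure hp.le α h _ _).trans_lt hz

lemma ofReal_le_lifespan {α p : ℝ} (hp : 0 < p) {μ : Measure (Space N)} [SFinite μ] {T : ℝ}
    (hT : 0 < T) (h : ∀ᵐ z ∂(slab N T), picardLimit α p μ z.1 z.2 < ∞) :
    ENNReal.ofReal T ≤ lifespan α p μ :=
  le_sSup ⟨T, hT, rfl, _, isMinimalSolution_picardLimit hp h⟩

lemma exists_picardLimit_lt_top_of_lt_lifespan {α p : ℝ} (hp : 0 ≤ p) {μ : Measure (Space N)}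
    {τ : ℝ≥0∞} (h : τ < lifespan α p μ) : ∃ T : ℝ, 0 < T ∧ τ < ENNReal.ofReal T ∧
      ∀ᵐ z ∂(slab N T), picardLimit α p μ z.1 z.2 < ∞ := by
  obtain ⟨_, ⟨T, hT, rfl, u, hu⟩, hτ⟩ := lt_sSup_iff.1 h
  exact ⟨T, hT, hτ, picardLimit_lt_top_of_isSolution hp hu.1⟩

/-! ### The Mittag-Leffler density -/

lemma mul_sin_le_sin_mul {s φ : ℝ} (hs : s ∈ Icc (0 : ℝ) 1) (hφ : φ ∈ Icc 0 Real.pi) :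
    s * Real.sin φ ≤ Real.sin (s * φ) := by
  have h := strictConcaveOn_sin_Icc.concaveOn.2 hφ ⟨le_rfl, Real.pi_pos.le⟩
    hs.1 (sub_nonneg.2 hs.2) (by ring)
  simpa using h

lemma sin_mul_pos {s φ : ℝ} (hs : s ∈ Ioc (0 : ℝ) 1) (hφ : φ ∈ Ioo 0 Real.pi) :
    0 < Real.sin (s * φ) :=
  (mul_pos hs.1 (Real.sin_pos_of_mem_Ioo hφ)).trans_le
    (mul_sin_le_sin_mul (Ioc_subset_Icc_self hs) (Ioo_subset_Icc_self hφ))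

lemma half_le_rpow_self_mul_rpow_self {a b : ℝ} (ha : 0 < a) (hb : 0 < b) (hab : a + b = 1) :
    1 / 2 ≤ a ^ a * b ^ b := by
  have amgm := Real.geom_mean_le_arith_mean2_weighted ha.le hb.le (inv_nonneg.2 ha.le)
    (inv_nonneg.2 hb.le) hab
  rw [mul_inv_cancel₀ ha.ne', mul_inv_cancel₀ hb.ne', Real.inv_rpow ha.le, Real.inv_rpow hb.le,
    ← mul_inv, inv_le_comm₀ (by positivity) (by norm_num)] at amgm
  norm_num at amgm ⊢
  exact amgm

lemma rpow_le_one_add_self {w s : ℝ} (hw : 0 ≤ w) (hs : s ∈ Icc (0 : ℝ) 1) : w ^ s ≤ 1 + w := by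
  rcases le_total w 1 with h | h
  · exact (Real.rpow_le_one hw h hs.1).trans (by linarith)
  · exact (Real.rpow_le_rpow_of_exponent_le h hs.2).trans (by rw [Real.rpow_one]; linarith)

section Zolotarev

variable {α φ w : ℝ}

lemma zolotarev_pos (hα : α ∈ Ioo (0 : ℝ) 1) (hφ : φ ∈ Ioo 0 Real.pi) : 0 < zolotarev α φ := by
  have sin_pos := Real.sin_pos_of_mem_Ioo hφ
  have sin_mul_pos_left := sin_mul_pos (Ioo_subset_Ioc_self hα) hφ
  have sin_mul_pos_right := sin_mul_pos (s := 1 - α) ⟨by linarith [hα.2], by linarith [hα.1]⟩ hφ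
  unfold zolotarev
  positivity

lemma zolotarev_rpow (hα : α ∈ Ioo (0 : ℝ) 1) (hφ : φ ∈ Ioo 0 Real.pi) :
    zolotarev α φ ^ (1 - α) =
      Real.sin (α * φ) ^ α * Real.sin ((1 - α) * φ) ^ (1 - α) / Real.sin φ := by
  have sin_pos := Real.sin_pos_of_mem_Ioo hφ
  have sin_mul_pos_left := sin_mul_pos (Ioo_subset_Ioc_self hα) hφ
  have sin_mul_pos_right := sin_mul_pos (s := 1 - α) ⟨by linarith [hα.2], by linarith [hα.1]⟩ hφ
  have one_sub_ne : 1 - α ≠ 0 := by linarith [hα.2]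
  unfold zolotarev
  rw [Real.div_rpow (by positivity) (by positivity),
    Real.mul_rpow (by positivity) sin_mul_pos_right.le, ← Real.rpow_mul sin_mul_pos_left.le,
    ← Real.rpow_mul sin_pos.le, div_mul_cancel₀ _ one_sub_ne, div_mul_cancel₀ _ one_sub_ne,
    Real.rpow_one]

lemma half_le_zolotarev_rpow (hα : α ∈ Ioo (0 : ℝ) 1) (hφ : φ ∈ Ioo 0 Real.pi) :
    1 / 2 ≤ zolotarev α φ ^ (1 - α) := by
  have sin_pos := Real.sin_pos_of_mem_Ioo hφ
  obtain ⟨α_pos, α_lt⟩ := hα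
  have β_pos : 0 < 1 - α := by linarith
  rw [zolotarev_rpow ⟨α_pos, α_lt⟩ hφ, le_div_iff₀ sin_pos]
  calc 1 / 2 * Real.sin φ ≤ α ^ α * (1 - α) ^ (1 - α) * Real.sin φ :=
        mul_le_mul_of_nonneg_right
          (half_le_rpow_self_mul_rpow_self α_pos β_pos (by ring)) sin_pos.le
    _ = α ^ α * (1 - α) ^ (1 - α) * (Real.sin φ ^ α * Real.sin φ ^ (1 - α)) := by
        rw [← Real.rpow_add sin_pos, add_sub_cancel, Real.rpow_one]
    _ = (α * Real.sin φ) ^ α * ((1 - α) * Real.sin φ) ^ (1 - α) := by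
        rw [Real.mul_rpow α_pos.le sin_pos.le, Real.mul_rpow β_pos.le sin_pos.le]
        ring
    _ ≤ Real.sin (α * φ) ^ α * Real.sin ((1 - α) * φ) ^ (1 - α) := by
        have hφ' := Ioo_subset_Icc_self hφ
        have sin_mul_nonneg := (sin_mul_pos ⟨α_pos, α_lt.le⟩ hφ).le
        have sin_ge_left := mul_sin_le_sin_mul ⟨α_pos.le, α_lt.le⟩ hφ'
        have sin_ge_right := mul_sin_le_sin_mul (s := 1 - α) ⟨β_pos.le, by linarith⟩ hφ'
        gcongr

lemma zolotarev_rpow_le (hα : α ∈ Ioo (0 : ℝ) 1) (hφ : φ ∈ Ioo 0 Real.pi) :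
    zolotarev α φ ^ (1 - α) ≤ (Real.sin φ)⁻¹ := by
  have sin_mul_pos_left := sin_mul_pos (Ioo_subset_Ioc_self hα) hφ
  have sin_mul_pos_right := sin_mul_pos (s := 1 - α) ⟨by linarith [hα.2], by linarith [hα.1]⟩ hφ
  rw [zolotarev_rpow hα hφ, div_eq_mul_inv]
  refine mul_le_of_le_one_left (inv_nonneg.2 (Real.sin_pos_of_mem_Ioo hφ).le) ?_
  exact mul_le_one₀ (Real.rpow_le_one sin_mul_pos_left.le (Real.sin_le_one _) hα.1.le)
    (Real.rpow_nonneg sin_mul_pos_right.le _)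
    (Real.rpow_le_one sin_mul_pos_right.le (Real.sin_le_one _) (by linarith [hα.2]))

/-- The function in Kanter's representation of `h_α` as the density of `(W / A_α(U)) ^ (1 - α)`,
where `U` is uniform on `(0, π)` and `W` is standard exponential and independent of `U`; see
`lintegral_mittagDensity_mul`. -/
noncomputable def kanter (α φ w : ℝ) : ℝ := (w / zolotarev α φ) ^ (1 - α)

lemma kanter_le (hα : α ∈ Ioo (0 : ℝ) 1) (hφ : φ ∈ Ioo 0 Real.pi) (hw : 0 ≤ w) :
    kanter α φ w ≤ 2 * w ^ (1 - α) := by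
  have half_le := half_le_zolotarev_rpow hα hφ
  have rpow_nonneg : 0 ≤ w ^ (1 - α) := Real.rpow_nonneg hw _
  rw [kanter, Real.div_rpow hw (zolotarev_pos hα hφ).le, div_le_iff₀ (by linarith)]
  nlinarith

lemma sin_mul_rpow_le_kanter (hα : α ∈ Ioo (0 : ℝ) 1) (hφ : φ ∈ Ioo 0 Real.pi) (hw : 0 ≤ w) :
    Real.sin φ * w ^ (1 - α) ≤ kanter α φ w := by
  have sin_pos := Real.sin_pos_of_mem_Ioo hφ
  have half_le := half_le_zolotarev_rpow hα hφ
  rw [kanter, Real.div_rpow hw (zolotarev_pos hα hφ).le, le_div_iff₀ (by linarith)]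
  calc Real.sin φ * w ^ (1 - α) * zolotarev α φ ^ (1 - α)
      ≤ Real.sin φ * w ^ (1 - α) * (Real.sin φ)⁻¹ :=
        mul_le_mul_of_nonneg_left (zolotarev_rpow_le hα hφ) (by positivity)
    _ = w ^ (1 - α) := by field_simp

end Zolotarev

lemma image_mul_rpow_Ioi {a b : ℝ} (ha : 0 < a) (hb : b ≠ 0) :
    (fun θ : ℝ => a * θ ^ b) '' Ioi 0 = Ioi 0 := by
  ext w
  constructor
  · rintro ⟨θ, hθ, rfl⟩
    exact mul_pos ha (Real.rpow_pos_of_pos hθ b)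
  · intro hw
    have hwa : 0 < w / a := div_pos hw ha
    exact ⟨(w / a) ^ b⁻¹, Real.rpow_pos_of_pos hwa _, by
      simp only [Real.rpow_inv_rpow hwa.le hb, mul_div_cancel₀ _ ha.ne']⟩

lemma lintegral_comp_mul_rpow_Ioi {a b : ℝ} (ha : 0 < a) (hb : 0 < b) (g : ℝ → ℝ≥0∞) :
    ∫⁻ w in Ioi 0, g w =
      ∫⁻ θ in Ioi 0, ENNReal.ofReal (a * (b * θ ^ (b - 1))) * g (a * θ ^ b) := by
  have subst := lintegral_image_eq_lintegral_abs_deriv_mul (s := Ioi (0 : ℝ))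
    (f := fun θ => a * θ ^ b) (f' := fun θ => a * (b * θ ^ (b - 1))) measurableSet_Ioi
    (fun θ hθ => ((Real.hasDerivAt_rpow_const (Or.inl (ne_of_gt hθ))).const_mul a).hasDerivWithinAt)
    (fun x hx y hy h => (Real.rpow_left_inj (le_of_lt hx) (le_of_lt hy) hb.ne').1
      (mul_left_cancel₀ ha.ne' h)) g
  rw [image_mul_rpow_Ioi ha hb.ne'] at subst
  rw [subst]
  refine setLIntegral_congr_fun measurableSet_Ioi fun θ hθ => ?_
  simp only [abs_of_pos (mul_pos ha (mul_pos hb (Real.rpow_pos_of_pos hθ (b - 1))))]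

lemma lintegral_zolotarev_substitution {α φ : ℝ} (hα : α ∈ Ioo (0 : ℝ) 1)
    (hφ : φ ∈ Ioo 0 Real.pi) (g : ℝ → ℝ≥0∞) :
    ∫⁻ θ in Ioi 0, ENNReal.ofReal (θ ^ (α / (1 - α)) / (Real.pi * (1 - α))) *
        ENNReal.ofReal (zolotarev α φ * Real.exp (-(zolotarev α φ * θ ^ (1 / (1 - α))))) * g θ =
      ENNReal.ofReal Real.pi⁻¹ *
        ∫⁻ w in Ioi 0, ENNReal.ofReal (Real.exp (-w)) * g (kanter α φ w) := by
  have β_pos : 0 < 1 - α := by linarith [hα.2]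
  have A_pos := zolotarev_pos hα hφ
  rw [lintegral_comp_mul_rpow_Ioi A_pos (one_div_pos.2 β_pos)
      fun w => ENNReal.ofReal (Real.exp (-w)) * g (kanter α φ w),
    ← lintegral_const_mul' _ _ ENNReal.ofReal_ne_top]
  refine setLIntegral_congr_fun measurableSet_Ioi fun θ (hθ : 0 < θ) => ?_
  have kanter_eq : kanter α φ (zolotarev α φ * θ ^ (1 / (1 - α))) = θ := by
    rw [kanter, mul_div_cancel_left₀ _ A_pos.ne', one_div, Real.rpow_inv_rpow hθ.le β_pos.ne']
  have exponent_eq : 1 / (1 - α) - 1 = α / (1 - α) := by field_simp; ring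
  simp only [kanter_eq, exponent_eq, ← mul_assoc]
  rw [← ENNReal.ofReal_mul (by positivity), ← ENNReal.ofReal_mul (by positivity),
    ← ENNReal.ofReal_mul (by positivity)]
  congr 2
  field_simp

lemma lintegral_mittagDensity_mul {α : ℝ} (hα : α ∈ Ioo (0 : ℝ) 1) {g : ℝ → ℝ≥0∞}
    (hg : Measurable g) :
    ∫⁻ θ in Ioi 0, mittagDensity α θ * g θ =
      ENNReal.ofReal Real.pi⁻¹ * ∫⁻ φ in Ioo 0 Real.pi, ∫⁻ w in Ioi 0,
        ENNReal.ofReal (Real.exp (-w)) * g (kanter α φ w) := by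
  have hA := measurable_zolotarev α
  have hin (θ : ℝ) : Measurable fun φ : ℝ => ENNReal.ofReal (zolotarev α φ *
      Real.exp (-(zolotarev α φ * θ ^ (1 / (1 - α))))) := by fun_prop
  calc ∫⁻ θ in Ioi 0, mittagDensity α θ * g θ
      = ∫⁻ θ in Ioi 0, ∫⁻ φ in Ioo 0 Real.pi,
          ENNReal.ofReal (θ ^ (α / (1 - α)) / (Real.pi * (1 - α))) *
          ENNReal.ofReal (zolotarev α φ *
            Real.exp (-(zolotarev α φ * θ ^ (1 / (1 - α))))) * g θ := by
        refine lintegral_congr fun θ => ?_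
        rw [lintegral_mul_const _ ((hin θ).const_mul _), lintegral_const_mul _ (hin θ)]
        rfl
    _ = ∫⁻ φ in Ioo 0 Real.pi, ∫⁻ θ in Ioi 0,
          ENNReal.ofReal (θ ^ (α / (1 - α)) / (Real.pi * (1 - α))) *
          ENNReal.ofReal (zolotarev α φ *
            Real.exp (-(zolotarev α φ * θ ^ (1 / (1 - α))))) * g θ := by
        refine lintegral_lintegral_swap (Measurable.aemeasurable ?_)
        have hg' : Measurable fun w : ℝ × ℝ => g w.1 := hg.comp measurable_fst
        have hA' : Measurable fun w : ℝ × ℝ => zolotarev α w.2 := hA.comp measurable_snd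
        exact Measurable.mul (by fun_prop) hg'
    _ = ∫⁻ φ in Ioo 0 Real.pi, ENNReal.ofReal Real.pi⁻¹ * ∫⁻ w in Ioi 0,
          ENNReal.ofReal (Real.exp (-w)) * g (kanter α φ w) :=
        setLIntegral_congr_fun measurableSet_Ioo fun φ hφ =>
          lintegral_zolotarev_substitution hα hφ g
    _ = _ := lintegral_const_mul' _ _ ENNReal.ofReal_ne_top

lemma ofReal_inv_pi_mul_setLIntegral_const (c : ℝ≥0∞) :
    ENNReal.ofReal Real.pi⁻¹ * ∫⁻ _ in Ioo 0 Real.pi, c = c := by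
  rw [setLIntegral_const, Real.volume_Ioo, sub_zero, mul_left_comm,
    ← ENNReal.ofReal_mul (inv_nonneg.2 Real.pi_pos.le), inv_mul_cancel₀ Real.pi_ne_zero,
    ENNReal.ofReal_one, mul_one]

lemma lintegral_exp_mul_rpow {s : ℝ} (hs : 0 < s) :
    ∫⁻ w in Ioi 0, ENNReal.ofReal (Real.exp (-w) * w ^ (s - 1)) =
      ENNReal.ofReal (Real.Gamma s) := by
  rw [Real.Gamma_eq_integral hs,
    ofReal_integral_eq_lintegral_ofReal (Real.GammaIntegral_convergent hs)]
  filter_upwards [ae_restrict_mem measurableSet_Ioi] with w (hw : 0 < w)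
  positivity

lemma lintegral_exp_neg : ∫⁻ w in Ioi (0 : ℝ), ENNReal.ofReal (Real.exp (-w)) = 1 := by
  simpa using lintegral_exp_mul_rpow (s := 1) one_pos

lemma lintegral_mittagDensity {α : ℝ} (hα : α ∈ Ioo (0 : ℝ) 1) :
    ∫⁻ θ in Ioi 0, mittagDensity α θ = 1 := by
  have kanter_one := lintegral_mittagDensity_mul hα (g := fun _ => 1) measurable_const
  simpa only [mul_one, lintegral_exp_neg, ofReal_inv_pi_mul_setLIntegral_const] using kanter_one

lemma lintegral_exp_mul_kanter_le {α φ : ℝ} (hα : α ∈ Ioo (0 : ℝ) 1) (hφ : φ ∈ Ioo 0 Real.pi) :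
    ∫⁻ w in Ioi 0, ENNReal.ofReal (Real.exp (-w)) * ENNReal.ofReal (kanter α φ w) ≤ 4 := by
  calc ∫⁻ w in Ioi 0, ENNReal.ofReal (Real.exp (-w)) * ENNReal.ofReal (kanter α φ w)
      ≤ ∫⁻ w in Ioi (0 : ℝ), (2 * ENNReal.ofReal (Real.exp (-w)) +
          2 * ENNReal.ofReal (Real.exp (-w) * w ^ ((2 : ℝ) - 1))) := by
        refine setLIntegral_mono (by fun_prop) fun w (hw : 0 < w) => ?_
        rw [← ENNReal.ofReal_mul (Real.exp_pos _).le, ← ENNReal.ofReal_ofNat 2,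
          ← ENNReal.ofReal_mul zero_le_two, ← ENNReal.ofReal_mul zero_le_two,
          ← ENNReal.ofReal_add (by positivity) (by positivity)]
        refine ENNReal.ofReal_le_ofReal ?_
        have kanter_le_linear : kanter α φ w ≤ 2 * (1 + w) :=
          (kanter_le hα hφ hw.le).trans (mul_le_mul_of_nonneg_left
            (rpow_le_one_add_self hw.le ⟨by linarith [hα.2], by linarith [hα.1]⟩) zero_le_two)
        calc Real.exp (-w) * kanter α φ w ≤ Real.exp (-w) * (2 * (1 + w)) :=
              mul_le_mul_of_nonneg_left kanter_le_linear (Real.exp_pos _).le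
          _ = _ := by norm_num; ring
    _ = 4 := by
        rw [lintegral_add_left (by fun_prop), lintegral_const_mul _ (by fun_prop),
          lintegral_const_mul _ (by fun_prop), lintegral_exp_neg,
          lintegral_exp_mul_rpow two_pos, Real.Gamma_two]
        norm_num

lemma lintegral_mul_mittagDensity_le {α : ℝ} (hα : α ∈ Ioo (0 : ℝ) 1) :
    ∫⁻ θ in Ioi 0, ENNReal.ofReal θ * mittagDensity α θ ≤ 4 := by
  simp_rw [mul_comm (ENNReal.ofReal _)]
  rw [lintegral_mittagDensity_mul hα ENNReal.measurable_ofReal]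
  calc _ ≤ ENNReal.ofReal Real.pi⁻¹ * ∫⁻ _ in Ioo 0 Real.pi, 4 :=
        mul_le_mul_right (setLIntegral_mono measurable_const fun _ hφ =>
          lintegral_exp_mul_kanter_le hα hφ) _
    _ = 4 := ofReal_inv_pi_mul_setLIntegral_const 4

lemma lintegral_mul_mittagDensity_mul_rpow_neg_le {α γ : ℝ} (hα : α ∈ Ioo (0 : ℝ) 1)
    (hγ : γ ∈ Icc (0 : ℝ) 1) :
    ∫⁻ θ in Ioi 0, ENNReal.ofReal θ * mittagDensity α θ * ENNReal.ofReal (θ ^ (-γ)) ≤ 5 := by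
  have hm := measurable_mittagDensity α
  calc _ ≤ ∫⁻ θ in Ioi 0, (mittagDensity α θ + ENNReal.ofReal θ * mittagDensity α θ) := by
        refine setLIntegral_mono (by fun_prop) fun θ (hθ : 0 < θ) => ?_
        rw [mul_right_comm, ← one_add_mul, ← ENNReal.ofReal_mul hθ.le, ← ENNReal.ofReal_one,
          ← ENNReal.ofReal_add zero_le_one hθ.le]
        refine mul_le_mul_left (ENNReal.ofReal_le_ofReal ?_) _
        have rpow_le := rpow_le_one_add_self hθ.le (s := 1 - γ)
          ⟨by linarith [hγ.2], by linarith [hγ.1]⟩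
        rwa [sub_eq_add_neg, Real.rpow_add hθ, Real.rpow_one] at rpow_le
    _ ≤ 1 + 4 := by
        rw [lintegral_add_left hm, lintegral_mittagDensity hα]
        exact add_le_add_right (lintegral_mul_mittagDensity_le hα) _
    _ = 5 := by norm_num

lemma sin_rpow_neg_le {δ φ : ℝ} (hδ : 0 ≤ δ) (hφ : φ ∈ Ioo 0 Real.pi) :
    Real.sin φ ^ (-δ) ≤ (2 / Real.pi) ^ (-δ) * (φ ^ (-δ) + (Real.pi - φ) ^ (-δ)) := by
  have sin_rpow_neg_le_of_le (x : ℝ) (hx : 0 < x) (hx2 : x ≤ Real.pi / 2) :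
      Real.sin x ^ (-δ) ≤ (2 / Real.pi) ^ (-δ) * x ^ (-δ) := by
    rw [← Real.mul_rpow (by positivity) hx.le]
    exact Real.rpow_le_rpow_of_nonpos (by positivity) (Real.mul_le_sin hx.le hx2)
      (neg_nonpos.2 hδ)
  have left_nonneg := Real.rpow_nonneg hφ.1.le (-δ)
  have right_nonneg := Real.rpow_nonneg (sub_pos.2 hφ.2).le (-δ)
  have const_nonneg : 0 ≤ (2 / Real.pi) ^ (-δ) := by positivity
  rcases le_total φ (Real.pi / 2) with h | h
  · exact (sin_rpow_neg_le_of_le φ hφ.1 h).trans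
      (mul_le_mul_of_nonneg_left (by linarith) const_nonneg)
  · rw [← Real.sin_pi_sub]
    exact (sin_rpow_neg_le_of_le (Real.pi - φ) (sub_pos.2 hφ.2) (by linarith)).trans
      (mul_le_mul_of_nonneg_left (by linarith) const_nonneg)

lemma lintegral_sin_rpow_neg_lt_top {δ : ℝ} (hδ : δ ∈ Ico (0 : ℝ) 1) :
    ∫⁻ φ in Ioo 0 Real.pi, ENNReal.ofReal (Real.sin φ ^ (-δ)) < ∞ := by
  have left_integrable : IntervalIntegrable (fun x : ℝ => x ^ (-δ)) volume 0 Real.pi :=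
    intervalIntegral.intervalIntegrable_rpow' (by linarith [hδ.2])
  have right_integrable :
      IntervalIntegrable (fun x : ℝ => (Real.pi - x) ^ (-δ)) volume 0 Real.pi := by
    simpa using (left_integrable.comp_sub_left Real.pi).symm
  have sum_integrable := (left_integrable.add right_integrable).const_mul ((2 / Real.pi) ^ (-δ))
  rw [intervalIntegrable_iff_integrableOn_Ioo_of_le Real.pi_pos.le] at sum_integrable
  exact (setLIntegral_mono_ae' measurableSet_Ioo (ae_of_all _ fun φ hφ =>
    ENNReal.ofReal_le_ofReal (sin_rpow_neg_le hδ.1 hφ))).trans_lt sum_integrable.lintegral_lt_top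

lemma kanter_rpow_neg_le {α δ φ w : ℝ} (hα : α ∈ Ioo (0 : ℝ) 1) (hδ : 0 ≤ δ)
    (hφ : φ ∈ Ioo 0 Real.pi) (hw : 0 < w) :
    kanter α φ w ^ (-δ) ≤ Real.sin φ ^ (-δ) * (1 + w ^ (1 - δ - 1)) := by
  have sin_pos := Real.sin_pos_of_mem_Ioo hφ
  have rpow_neg_le : (w ^ (1 - α)) ^ (-δ) ≤ 1 + w ^ (1 - δ - 1) := by
    rw [← Real.rpow_mul hw.le]
    have rpow_pos := Real.rpow_pos_of_pos hw (1 - δ - 1)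
    rcases le_total w 1 with h | h
    · linarith [Real.rpow_le_rpow_of_exponent_ge hw h
        (show 1 - δ - 1 ≤ (1 - α) * -δ by nlinarith [hα.1])]
    · linarith [Real.rpow_le_one_of_one_le_of_nonpos h
        (show (1 - α) * -δ ≤ 0 by nlinarith [hα.2])]
  calc kanter α φ w ^ (-δ) ≤ (Real.sin φ * w ^ (1 - α)) ^ (-δ) :=
        Real.rpow_le_rpow_of_nonpos (by positivity) (sin_mul_rpow_le_kanter hα hφ hw.le)
          (neg_nonpos.2 hδ)
    _ = Real.sin φ ^ (-δ) * (w ^ (1 - α)) ^ (-δ) := Real.mul_rpow sin_pos.le (by positivity)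
    _ ≤ _ := mul_le_mul_of_nonneg_left rpow_neg_le (by positivity)

lemma exists_lintegral_mittagDensity_mul_rpow_neg_le {δ : ℝ} (hδ : δ ∈ Ico (0 : ℝ) 1) :
    ∃ K : ℝ≥0∞, K < ∞ ∧ ∀ α ∈ Ioo (0 : ℝ) 1,
      ∫⁻ θ in Ioi 0, mittagDensity α θ * ENNReal.ofReal (θ ^ (-δ)) ≤ K := by
  set I := ∫⁻ φ in Ioo 0 Real.pi, ENNReal.ofReal (Real.sin φ ^ (-δ)) with I_def
  set L := ∫⁻ w in Ioi (0 : ℝ), (ENNReal.ofReal (Real.exp (-w)) +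
    ENNReal.ofReal (Real.exp (-w) * w ^ ((1 - δ) - 1))) with L_def
  have L_lt_top : L < ∞ := by
    rw [L_def, lintegral_add_left (by fun_prop), lintegral_exp_neg,
      lintegral_exp_mul_rpow (by linarith [hδ.2])]
    exact ENNReal.add_lt_top.2 ⟨ENNReal.one_lt_top, ENNReal.ofReal_lt_top⟩
  refine ⟨ENNReal.ofReal Real.pi⁻¹ * (I * L), ENNReal.mul_lt_top ENNReal.ofReal_lt_top
    (ENNReal.mul_lt_top (lintegral_sin_rpow_neg_lt_top hδ) L_lt_top), fun α hα => ?_⟩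
  rw [lintegral_mittagDensity_mul hα (by fun_prop), I_def, ← lintegral_mul_const _ (by fun_prop)]
  refine mul_le_mul_right (setLIntegral_mono (by fun_prop) fun φ hφ => ?_) _
  have sin_rpow_nonneg := Real.rpow_nonneg (Real.sin_pos_of_mem_Ioo hφ).le (-δ)
  rw [L_def, ← lintegral_const_mul _ (by fun_prop)]
  refine setLIntegral_mono (by fun_prop) fun w (hw : 0 < w) => ?_
  rw [← ENNReal.ofReal_mul (Real.exp_pos _).le,
    ← ENNReal.ofReal_add (by positivity) (by positivity), ← ENNReal.ofReal_mul sin_rpow_nonneg]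
  refine ENNReal.ofReal_le_ofReal ?_
  calc Real.exp (-w) * kanter α φ w ^ (-δ)
      ≤ Real.exp (-w) * (Real.sin φ ^ (-δ) * (1 + w ^ (1 - δ - 1))) :=
        mul_le_mul_of_nonneg_left (kanter_rpow_neg_le hα hδ.1 hφ hw) (Real.exp_pos _).le
    _ = _ := by ring

lemma half_le_sin {φ : ℝ} (hφ : φ ∈ Icc (Real.pi / 6) (Real.pi - Real.pi / 6)) :
    1 / 2 ≤ Real.sin φ := by
  have pi_pos := Real.pi_pos
  rw [← Real.sin_pi_div_six]
  rcases le_total φ (Real.pi / 2) with h | h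
  · exact Real.sin_le_sin_of_le_of_le_pi_div_two (by linarith) h hφ.1
  · rw [← Real.sin_pi_sub φ]
    exact Real.sin_le_sin_of_le_of_le_pi_div_two (by linarith) (by linarith) (by linarith [hφ.2])

lemma kanter_mem_Icc {α φ w : ℝ} (hα : α ∈ Ioo (0 : ℝ) 1)
    (hφ : φ ∈ Ioo (Real.pi / 6) (Real.pi - Real.pi / 6)) (hw : w ∈ Icc (1 : ℝ) 2) :
    kanter α φ w ∈ Icc (1 / 2 : ℝ) 4 := by
  have pi_pos := Real.pi_pos
  have hφ' : φ ∈ Ioo 0 Real.pi := ⟨by linarith [hφ.1], by linarith [hφ.2]⟩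
  have w_nonneg : 0 ≤ w := zero_le_one.trans hw.1
  have half_le_sin := half_le_sin (Ioo_subset_Icc_self hφ)
  have one_le_rpow := Real.one_le_rpow hw.1 (z := 1 - α) (by linarith [hα.2])
  have rpow_le := Real.rpow_le_self_of_one_le hw.1 (show 1 - α ≤ 1 by linarith [hα.1])
  constructor
  · exact le_trans (by nlinarith) (sin_mul_rpow_le_kanter hα hφ' w_nonneg)
  · exact (kanter_le hα hφ' w_nonneg).trans (by linarith [hw.2])

lemma le_lintegral_exp_mul_kanter {α φ : ℝ} (hα : α ∈ Ioo (0 : ℝ) 1)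
    (hφ : φ ∈ Ioo (Real.pi / 6) (Real.pi - Real.pi / 6)) {g : ℝ → ℝ≥0∞} {m : ℝ≥0∞}
    (hm : ∀ θ ∈ Icc (1 / 2 : ℝ) 4, m ≤ g θ) :
    ENNReal.ofReal (Real.exp (-2)) * m ≤
      ∫⁻ w in Ioi 0, ENNReal.ofReal (Real.exp (-w)) * g (kanter α φ w) := by
  calc ENNReal.ofReal (Real.exp (-2)) * m
      = ∫⁻ _ in Ioo (1 : ℝ) 2, ENNReal.ofReal (Real.exp (-2)) * m := by
        rw [setLIntegral_const, Real.volume_Ioo]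
        norm_num
    _ ≤ ∫⁻ w in Ioo (1 : ℝ) 2, ENNReal.ofReal (Real.exp (-w)) * g (kanter α φ w) :=
        setLIntegral_mono' measurableSet_Ioo fun w hw =>
          mul_le_mul' (ENNReal.ofReal_le_ofReal (Real.exp_le_exp.2 (neg_le_neg hw.2.le)))
            (hm _ (kanter_mem_Icc hα hφ (Ioo_subset_Icc_self hw)))
    _ ≤ _ := lintegral_mono_set fun w hw => zero_lt_one.trans hw.1

lemma le_lintegral_mittagDensity_mul {α : ℝ} (hα : α ∈ Ioo (0 : ℝ) 1) {g : ℝ → ℝ≥0∞}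
    (hg : Measurable g) {m : ℝ≥0∞} (hm : ∀ θ ∈ Icc (1 / 2 : ℝ) 4, m ≤ g θ) :
    ENNReal.ofReal (2 / 3 * Real.exp (-2)) * m ≤ ∫⁻ θ in Ioi 0, mittagDensity α θ * g θ := by
  have pi_pos := Real.pi_pos
  rw [lintegral_mittagDensity_mul hα hg]
  calc ENNReal.ofReal (2 / 3 * Real.exp (-2)) * m
      = ENNReal.ofReal Real.pi⁻¹ * ∫⁻ _ in Ioo (Real.pi / 6) (Real.pi - Real.pi / 6),
          ENNReal.ofReal (Real.exp (-2)) * m := by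
        rw [setLIntegral_const, Real.volume_Ioo, mul_comm (ENNReal.ofReal (Real.exp (-2)) * m),
          ← mul_assoc, ← mul_assoc, ← ENNReal.ofReal_mul (by positivity),
          ← ENNReal.ofReal_mul (mul_nonneg (by positivity) (by linarith))]
        congr 2
        field_simp
        ring
    _ ≤ ENNReal.ofReal Real.pi⁻¹ * ∫⁻ φ in Ioo (Real.pi / 6) (Real.pi - Real.pi / 6),
          ∫⁻ w in Ioi 0, ENNReal.ofReal (Real.exp (-w)) * g (kanter α φ w) :=
        mul_le_mul_right (setLIntegral_mono' measurableSet_Ioo fun φ hφ =>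
          le_lintegral_exp_mul_kanter hα hφ hm) _
    _ ≤ _ := mul_le_mul_right
        (lintegral_mono_set (Ioo_subset_Ioo (by positivity) (by linarith))) _

/-! ### Integral inequalities -/

section Integral

variable {S X : Type*} [MeasurableSpace S] [MeasurableSpace X] {ν : Measure S} {μ : Measure X}

lemma rpow_lintegral_mul_le {q : ℝ} (hq : 1 ≤ q) {a f : S → ℝ≥0∞} (ha : AEMeasurable a ν)
    (hf : AEMeasurable f ν) :
    (∫⁻ s, a s * f s ∂ν) ^ q ≤ (∫⁻ s, a s ∂ν) ^ (q - 1) * ∫⁻ s, a s * f s ^ q ∂ν := by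
  have q_pos : 0 < q := by linarith
  have weight_nonneg : 0 ≤ 1 - 1 / q := sub_nonneg.2 ((div_le_one q_pos).2 hq)
  have factorization (s : S) :
      a s * f s = a s ^ (1 - 1 / q) * (a s * f s ^ q) ^ (1 / q) := by
    rw [ENNReal.mul_rpow_of_nonneg _ _ (by positivity), ← mul_assoc, ← ENNReal.rpow_mul,
      ← ENNReal.rpow_add_of_nonneg _ _ weight_nonneg (by positivity), sub_add_cancel,
      mul_one_div_cancel q_pos.ne', ENNReal.rpow_one, ENNReal.rpow_one]
  calc (∫⁻ s, a s * f s ∂ν) ^ q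
      ≤ ((∫⁻ s, a s ∂ν) ^ (1 - 1 / q) * (∫⁻ s, a s * f s ^ q ∂ν) ^ (1 / q)) ^ q := by
        rw [lintegral_congr factorization]
        exact ENNReal.rpow_le_rpow (ENNReal.lintegral_mul_norm_pow_le ha
          (ha.mul (hf.pow_const q)) weight_nonneg (by positivity) (sub_add_cancel _ _)) q_pos.le
    _ = (∫⁻ s, a s ∂ν) ^ (q - 1) * ∫⁻ s, a s * f s ^ q ∂ν := by
        rw [ENNReal.mul_rpow_of_nonneg _ _ q_pos.le, ← ENNReal.rpow_mul, ← ENNReal.rpow_mul,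
          one_div_mul_cancel q_pos.ne', ENNReal.rpow_one, sub_mul, one_mul,
          one_div_mul_cancel q_pos.ne']

lemma lintegral_rpow_lintegral_mul_le_of_le [SFinite ν] [SFinite μ] {q : ℝ} (hq : 1 ≤ q)
    {w : S → ℝ≥0∞} (hw : Measurable w) {H : S → X → ℝ≥0∞} (hH : Measurable (Function.uncurry H))
    {C : ℝ≥0∞} (h : ∀ᵐ s ∂ν, ∫⁻ x, H s x ^ q ∂μ ≤ C) :
    ∫⁻ x, (∫⁻ s, w s * H s x ∂ν) ^ q ∂μ ≤ (∫⁻ s, w s ∂ν) ^ q * C := by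
  have measurable_rpow : Measurable (Function.uncurry fun s x => H s x ^ q) := hH.pow_const q
  have measurable_integrand : Measurable fun z : X × S => w z.2 * H z.2 z.1 ^ q :=
    (hw.comp measurable_snd).mul (measurable_rpow.comp measurable_swap)
  calc ∫⁻ x, (∫⁻ s, w s * H s x ∂ν) ^ q ∂μ
      ≤ ∫⁻ x, (∫⁻ s, w s ∂ν) ^ (q - 1) * ∫⁻ s, w s * H s x ^ q ∂ν ∂μ :=
        lintegral_mono fun x => rpow_lintegral_mul_le hq hw.aemeasurable
          (hH.comp measurable_prodMk_right).aemeasurable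
    _ = (∫⁻ s, w s ∂ν) ^ (q - 1) * ∫⁻ s, w s * ∫⁻ x, H s x ^ q ∂μ ∂ν := by
        rw [lintegral_const_mul _ measurable_integrand.lintegral_prod_right',
          lintegral_lintegral_swap (f := fun x s => w s * H s x ^ q)
            measurable_integrand.aemeasurable]
        congr 1
        exact lintegral_congr fun s =>
          lintegral_const_mul _ (measurable_rpow.comp measurable_prodMk_left)
    _ ≤ (∫⁻ s, w s ∂ν) ^ (q - 1) * ∫⁻ s, w s * C ∂ν := by
        refine mul_le_mul_right (lintegral_mono_ae ?_) _
        filter_upwards [h] with s hs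
        exact mul_le_mul_right hs _
    _ = (∫⁻ s, w s ∂ν) ^ q * C := by
        rw [lintegral_mul_const _ hw, ← mul_assoc]
        congr 1
        nth_rewrite 2 [← ENNReal.rpow_one (∫⁻ s, w s ∂ν)]
        rw [← ENNReal.rpow_add_of_nonneg _ _ (by linarith) zero_le_one, sub_add_cancel]

-- Minkowski's integral inequality, for a prescribed bound `b s * C ^ (1 / q)` of `‖F s‖_q`.
lemma lintegral_rpow_lintegral_mul_le [SFinite ν] [SFinite μ] {q : ℝ} (hq : 1 ≤ q)
    {a b : S → ℝ≥0∞} (ha : Measurable a) (hb : Measurable b) (hb_ne_zero : ∀ᵐ s ∂ν, b s ≠ 0)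
    (hb_ne_top : ∀ᵐ s ∂ν, b s ≠ ∞) {F : S → X → ℝ≥0∞} (hF : Measurable (Function.uncurry F))
    {C : ℝ≥0∞} (h : ∀ᵐ s ∂ν, ∫⁻ x, F s x ^ q ∂μ ≤ b s ^ q * C) :
    ∫⁻ x, (∫⁻ s, a s * F s x ∂ν) ^ q ∂μ ≤ (∫⁻ s, a s * b s ∂ν) ^ q * C := by
  have q_nonneg : 0 ≤ q := by linarith
  have normalize (x : X) :
      ∫⁻ s, a s * F s x ∂ν = ∫⁻ s, a s * b s * ((b s)⁻¹ * F s x) ∂ν := by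
    refine lintegral_congr_ae ?_
    filter_upwards [hb_ne_zero, hb_ne_top] with s hs_zero hs_top
    rw [mul_assoc, ENNReal.mul_inv_cancel_left hs_zero hs_top]
  simp_rw [normalize]
  refine lintegral_rpow_lintegral_mul_le_of_le hq (ha.mul hb)
    ((hb.inv.comp measurable_fst).mul hF) ?_
  filter_upwards [hb_ne_zero, hb_ne_top, h] with s hs_zero hs_top hs
  have measurable_F : Measurable (F s) := hF.comp measurable_prodMk_left
  simp_rw [ENNReal.mul_rpow_of_nonneg _ _ q_nonneg]
  rw [lintegral_const_mul _ (measurable_F.pow_const q)]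
  calc (b s)⁻¹ ^ q * ∫⁻ x, F s x ^ q ∂μ ≤ (b s)⁻¹ ^ q * (b s ^ q * C) := mul_le_mul_right hs _
    _ = C := by
        rw [← mul_assoc, ← ENNReal.mul_rpow_of_nonneg _ _ q_nonneg,
          ENNReal.inv_mul_cancel hs_zero hs_top, ENNReal.one_rpow, one_mul]

lemma lintegral_rpow_le_of_rpow_le {r q : ℝ} (hr : 0 < r) (hrq : r ≤ q) {g : X → ℝ≥0∞}
    (hg : Measurable g) {M : ℝ≥0∞} (hM : ∀ x, g x ^ r ≤ M) :
    ∫⁻ x, g x ^ q ∂μ ≤ M ^ (q / r - 1) * ∫⁻ x, g x ^ r ∂μ := by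
  have exponent_nonneg : 0 ≤ q / r - 1 := sub_nonneg.2 ((one_le_div hr).2 hrq)
  rw [← lintegral_const_mul _ (hg.pow_const r)]
  refine lintegral_mono fun x => ?_
  calc g x ^ q = (g x ^ r) ^ (q / r - 1) * g x ^ r := by
        rw [← ENNReal.rpow_mul, ← ENNReal.rpow_add_of_nonneg _ _ (by positivity) hr.le,
          mul_sub, mul_div_cancel₀ _ hr.ne', mul_one, sub_add_cancel]
    _ ≤ M ^ (q / r - 1) * g x ^ r :=
        mul_le_mul_left (ENNReal.rpow_le_rpow (hM x) exponent_nonneg) _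

end Integral

/-! ### The heat semigroup -/

section HeatKernel

variable {t : ℝ}

lemma heatKernel_nonneg (ht : 0 ≤ t) (x : Space N) : 0 ≤ heatKernel N t x := by
  unfold heatKernel
  positivity

lemma lintegral_heatKernel (ht : 0 < t) :
    ∫⁻ x : Space N, ENNReal.ofReal (heatKernel N t x) = 1 := by
  have heatKernel_eq : heatKernel N t = fun x =>
      (4 * Real.pi * t) ^ (-((N : ℝ) / 2)) * Real.exp (-(1 / (4 * t)) * ‖x‖ ^ 2) := by
    funext x
    rw [heatKernel, neg_div, neg_mul, one_div_mul_eq_div]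
  have integral_gaussian := GaussianFourier.integral_rexp_neg_mul_sq_norm (V := Space N)
    (show 0 < 1 / (4 * t) by positivity)
  rw [finrank_euclideanSpace_fin, show Real.pi / (1 / (4 * t)) = 4 * Real.pi * t by field_simp]
    at integral_gaussian
  have normalizer_pos : 0 < (4 * Real.pi * t) ^ ((N : ℝ) / 2) := by positivity
  -- a non-integrable function would have integral zero
  have integrable_gaussian : Integrable fun x : Space N => Real.exp (-(1 / (4 * t)) * ‖x‖ ^ 2) :=
    not_imp_comm.1 integral_undef (integral_gaussian ▸ normalizer_pos.ne')
  rw [← ofReal_integral_eq_lintegral_ofReal (heatKernel_eq ▸ integrable_gaussian.const_mul _)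
    (ae_of_all _ fun x => heatKernel_nonneg ht.le x), heatKernel_eq, integral_const_mul,
    integral_gaussian, Real.rpow_neg (by positivity), inv_mul_cancel₀ normalizer_pos.ne',
    ENNReal.ofReal_one]

lemma lintegral_heatKernel_sub_left (ht : 0 < t) (x : Space N) :
    ∫⁻ y : Space N, ENNReal.ofReal (heatKernel N t (x - y)) = 1 := by
  rw [lintegral_sub_left_eq_self (fun y => ENNReal.ofReal (heatKernel N t y)) x,
    lintegral_heatKernel ht]

lemma lintegral_heatKernel_sub_right (ht : 0 < t) (y : Space N) :
    ∫⁻ x : Space N, ENNReal.ofReal (heatKernel N t (x - y)) = 1 := by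
  rw [lintegral_sub_right_eq_self (fun x => ENNReal.ofReal (heatKernel N t x)) y,
    lintegral_heatKernel ht]

lemma heatKernel_le (ht : 0 < t) (x : Space N) : heatKernel N t x ≤ t ^ (-((N : ℝ) / 2)) := by
  have pi_gt := Real.pi_gt_three
  calc heatKernel N t x ≤ (4 * Real.pi * t) ^ (-((N : ℝ) / 2)) :=
        mul_le_of_le_one_right (by positivity) (Real.exp_le_one_iff.2
          (div_nonpos_of_nonpos_of_nonneg (neg_nonpos.2 (by positivity)) (by positivity)))
    _ ≤ t ^ (-((N : ℝ) / 2)) :=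
        Real.rpow_le_rpow_of_nonpos ht (by nlinarith) (neg_nonpos.2 (by positivity))

lemma le_heatKernel (ht : 0 < t) {x : Space N} (hx : ‖x‖ ≤ √t / 2) :
    (4 * Real.pi * t) ^ (-((N : ℝ) / 2)) * Real.exp (-(1 / 16)) ≤ heatKernel N t x := by
  refine mul_le_mul_of_nonneg_left (Real.exp_le_exp.2 ?_) (by positivity)
  rw [neg_div, neg_le_neg_iff, div_le_iff₀ (by positivity)]
  calc ‖x‖ ^ 2 ≤ (√t / 2) ^ 2 := pow_le_pow_left₀ (norm_nonneg _) hx 2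
    _ = 1 / 16 * (4 * t) := by rw [div_pow, Real.sq_sqrt ht.le]; ring

end HeatKernel

section Heat

variable {t : ℝ} {f : Space N → ℝ≥0∞}

lemma heat_le_of_le (ht : 0 < t) (hf : Measurable f) {a : ℝ≥0∞} (h : ∀ y, f y ≤ a)
    (x : Space N) : heat t (volume.withDensity f) x ≤ a := by
  calc heat t (volume.withDensity f) x
      ≤ ∫⁻ y, ENNReal.ofReal (heatKernel N t (x - y)) * a := by
        rw [heat_withDensity t hf]
        exact lintegral_mono fun y => mul_le_mul_right (h y) _
    _ = a := by
        rw [lintegral_mul_const _ (measurable_heatKernel_sub t x),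
          lintegral_heatKernel_sub_left ht, one_mul]

lemma rpow_heat_le {r : ℝ} (ht : 0 < t) (hr : 1 ≤ r) (hf : Measurable f) (x : Space N) :
    heat t (volume.withDensity f) x ^ r ≤
      ∫⁻ y, ENNReal.ofReal (heatKernel N t (x - y)) * f y ^ r := by
  have jensen := rpow_lintegral_mul_le hr (measurable_heatKernel_sub t x).aemeasurable
    (hf.aemeasurable (μ := volume))
  rwa [lintegral_heatKernel_sub_left ht, ENNReal.one_rpow, one_mul,
    ← heat_withDensity t hf] at jensen

lemma rpow_heat_le_mul_lintegral {r : ℝ} (ht : 0 < t) (hr : 1 ≤ r) (hf : Measurable f)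
    (x : Space N) : heat t (volume.withDensity f) x ^ r ≤
      ENNReal.ofReal (t ^ (-((N : ℝ) / 2))) * ∫⁻ y, f y ^ r := by
  refine (rpow_heat_le ht hr hf x).trans ?_
  rw [← lintegral_const_mul _ (hf.pow_const r)]
  exact lintegral_mono fun y => mul_le_mul_left (ENNReal.ofReal_le_ofReal (heatKernel_le ht _)) _

lemma lintegral_rpow_heat_le {r : ℝ} (ht : 0 < t) (hr : 1 ≤ r) (hf : Measurable f) :
    ∫⁻ x, heat t (volume.withDensity f) x ^ r ≤ ∫⁻ x, f x ^ r := by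
  have measurable_kernel : Measurable fun z : Space N × Space N =>
      ENNReal.ofReal (heatKernel N t (z.1 - z.2)) :=
    (measurable_heatKernel.comp (f := fun z : Space N × Space N => (t, z.1 - z.2))
      (by fun_prop)).ennreal_ofReal
  have measurable_integrand : Measurable fun z : Space N × Space N =>
      ENNReal.ofReal (heatKernel N t (z.1 - z.2)) * f z.2 ^ r :=
    measurable_kernel.mul ((hf.pow_const r).comp measurable_snd)
  calc ∫⁻ x, heat t (volume.withDensity f) x ^ r
      ≤ ∫⁻ x, ∫⁻ y, ENNReal.ofReal (heatKernel N t (x - y)) * f y ^ r :=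
        lintegral_mono fun x => rpow_heat_le ht hr hf x
    _ = ∫⁻ y, ∫⁻ x, ENNReal.ofReal (heatKernel N t (x - y)) * f y ^ r :=
        lintegral_lintegral_swap (f := fun x y => ENNReal.ofReal (heatKernel N t (x - y)) * f y ^ r)
          measurable_integrand.aemeasurable
    _ = ∫⁻ y, (∫⁻ x, ENNReal.ofReal (heatKernel N t (x - y))) * f y ^ r :=
        lintegral_congr fun y => lintegral_mul_const _ (measurable_heatKernel.comp
          (f := fun x : Space N => (t, x - y)) (by fun_prop)).ennreal_ofReal
    _ = ∫⁻ x, f x ^ r := by simp_rw [lintegral_heatKernel_sub_right ht, one_mul]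

/-- The exponent `N/2 (1/r - 1/q)` of the decay in time of the heat semigroup from `L^r` to
`L^q`. -/
noncomputable def smoothingExponent (N : ℕ) (r q : ℝ) : ℝ := (N : ℝ) / 2 * (1 / r - 1 / q)

lemma lintegral_heat_rpow_le {r q : ℝ} (ht : 0 < t) (hr : 1 ≤ r) (hrq : r ≤ q)
    (hf : Measurable f) :
    ∫⁻ x, heat t (volume.withDensity f) x ^ q ≤
      ENNReal.ofReal (t ^ (-smoothingExponent N r q)) ^ q * (∫⁻ x, f x ^ r) ^ (q / r) := by
  have r_pos : 0 < r := by linarith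
  have q_pos : 0 < q := by linarith
  have exponent_nonneg : 0 ≤ q / r - 1 := sub_nonneg.2 ((one_le_div r_pos).2 hrq)
  have measurable_heat_t : Measurable fun x : Space N => heat t (volume.withDensity f) x :=
    (measurable_heat _).comp measurable_prodMk_left
  calc ∫⁻ x, heat t (volume.withDensity f) x ^ q
      ≤ (ENNReal.ofReal (t ^ (-((N : ℝ) / 2))) * ∫⁻ x, f x ^ r) ^ (q / r - 1) *
          ∫⁻ x, heat t (volume.withDensity f) x ^ r :=
        lintegral_rpow_le_of_rpow_le r_pos hrq measurable_heat_t
          (rpow_heat_le_mul_lintegral ht hr hf)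
    _ ≤ (ENNReal.ofReal (t ^ (-((N : ℝ) / 2))) * ∫⁻ x, f x ^ r) ^ (q / r - 1) *
          ∫⁻ x, f x ^ r := mul_le_mul_right (lintegral_rpow_heat_le ht hr hf) _
    _ = ENNReal.ofReal (t ^ (-smoothingExponent N r q)) ^ q * (∫⁻ x, f x ^ r) ^ (q / r) := by
        rw [ENNReal.mul_rpow_of_nonneg _ _ exponent_nonneg, mul_assoc,
          ENNReal.ofReal_rpow_of_pos (by positivity), ENNReal.ofReal_rpow_of_pos (by positivity),
          ← Real.rpow_mul ht.le, ← Real.rpow_mul ht.le]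
        congr 1
        · rw [smoothingExponent]
          congr 2
          field_simp
        · nth_rewrite 2 [← ENNReal.rpow_one (∫⁻ x, f x ^ r)]
          rw [← ENNReal.rpow_add_of_nonneg _ _ exponent_nonneg zero_le_one, sub_add_cancel]

end Heat

lemma exists_ball_subset_ball_dist_le {E : Type*} [NormedAddCommGroup E] [NormedSpace ℝ E]
    {c x : E} {r ρ : ℝ} (hx : x ∈ Metric.closedBall c r) (hρ : 0 < ρ) (hρr : ρ ≤ r) :
    ∃ z, Metric.ball z ρ ⊆ Metric.ball c r ∧ dist x z ≤ ρ := by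
  have r_pos : 0 < r := hρ.trans_le hρr
  have ratio_nonneg : 0 ≤ ρ / r := by positivity
  have ratio_le : ρ / r ≤ 1 := (div_le_one r_pos).2 hρr
  refine ⟨AffineMap.lineMap x c (ρ / r), Metric.ball_subset_ball' ?_, ?_⟩
  · rw [dist_lineMap_right, Real.norm_of_nonneg (by linarith)]
    calc ρ + (1 - ρ / r) * dist x c ≤ ρ + (1 - ρ / r) * r := by
          gcongr
          exact hx
      _ = r := by field_simp; ring
  · rw [dist_left_lineMap, Real.norm_of_nonneg ratio_nonneg]
    calc ρ / r * dist x c ≤ ρ / r * r := by gcongr; exact hx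
      _ = ρ := div_mul_cancel₀ _ r_pos.ne'

/-- The mass which the lower bound `le_heatKernel` of the heat kernel at time `t` gives to a ball
of radius `√t / 4`; it depends on the dimension only. -/
noncomputable def ballHeatBound (N : ℕ) : ℝ :=
  unitBallVolume N * (4 : ℝ) ^ (-(N : ℝ)) * (4 * Real.pi) ^ (-((N : ℝ) / 2)) *
    Real.exp (-(1 / 16))

lemma unitBallVolume_pos (N : ℕ) : 0 < unitBallVolume N :=
  ENNReal.toReal_pos (Metric.measure_ball_pos _ _ one_pos).ne' measure_ball_lt_top.ne

lemma ballHeatBound_pos (N : ℕ) : 0 < ballHeatBound N := by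
  have volume_pos := unitBallVolume_pos N
  unfold ballHeatBound
  positivity

lemma volume_ball_eq (x : Space N) {r : ℝ} (hr : 0 < r) :
    volume (Metric.ball x r) = ENNReal.ofReal (r ^ N * unitBallVolume N) := by
  rw [Measure.addHaar_ball_of_pos _ _ hr, finrank_euclideanSpace_fin,
    ENNReal.ofReal_mul (by positivity), unitBallVolume,
    ENNReal.ofReal_toReal measure_ball_lt_top.ne]

lemma ofReal_mul_volume_ball_sqrt {t : ℝ} (ht : 0 < t) (z : Space N) :
    ENNReal.ofReal ((4 * Real.pi * t) ^ (-((N : ℝ) / 2)) * Real.exp (-(1 / 16))) *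
      volume (Metric.ball z (√t / 4)) = ENNReal.ofReal (ballHeatBound N) := by
  have sqrt_pow : √t ^ N = t ^ ((N : ℝ) / 2) := by
    rw [Real.sqrt_eq_rpow, ← Real.rpow_natCast, ← Real.rpow_mul ht.le, one_div_mul_eq_div]
  have rpow_neg_mul : t ^ (-((N : ℝ) / 2)) * t ^ ((N : ℝ) / 2) = 1 := by
    rw [← Real.rpow_add ht, neg_add_cancel, Real.rpow_zero]
  rw [volume_ball_eq z (by positivity), ← ENNReal.ofReal_mul (by positivity), div_pow, sqrt_pow,
    Real.mul_rpow (by positivity) ht.le, ballHeatBound, Real.rpow_neg zero_le_four (N : ℝ),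
    Real.rpow_natCast]
  congr 1
  generalize t ^ (-((N : ℝ) / 2)) = s, (4 * Real.pi) ^ (-((N : ℝ) / 2)) = c at rpow_neg_mul ⊢
  linear_combination
    unitBallVolume N * ((4 : ℝ) ^ N)⁻¹ * c * Real.exp (-(1 / 16)) * rpow_neg_mul

lemma ballHeatBound_mul_le_heat {r t : ℝ} (hr : 0 < r) (ht : 0 < t) (htr : t ≤ 4 * r ^ 2)
    {c x : Space N} (hx : x ∈ Metric.closedBall c r) {f : Space N → ℝ≥0∞} (hf : Measurable f)
    {a : ℝ≥0∞} (ha : ∀ y ∈ Metric.ball c r, a ≤ f y) :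
    ENNReal.ofReal (ballHeatBound N) * a ≤ heat t (volume.withDensity f) x := by
  have sqrt_le : √t ≤ 2 * r := Real.sqrt_le_iff.2 ⟨by positivity, by linarith⟩
  obtain ⟨z, ball_subset, dist_le⟩ :=
    exists_ball_subset_ball_dist_le (ρ := √t / 4) hx (by positivity) (by linarith)
  rw [heat_withDensity t hf, ← ofReal_mul_volume_ball_sqrt ht z, mul_right_comm,
    ← setLIntegral_const]
  refine (setLIntegral_mono ((measurable_heatKernel_sub t x).mul hf) fun y hy => ?_).trans
    (setLIntegral_le_lintegral _ _)
  have norm_le : ‖x - y‖ ≤ √t / 2 := by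
    rw [← dist_eq_norm]
    linarith [dist_triangle_right x y z, Metric.mem_ball.1 hy]
  exact mul_le_mul' (ENNReal.ofReal_le_ofReal (le_heatKernel ht norm_le)) (ha y (ball_subset hy))

/-! ### Weakly singular time integrals -/

section TimeIntegrals

lemma lintegral_rpow_Ioo {t c : ℝ} (ht : 0 ≤ t) (hc : -1 < c) :
    ∫⁻ s in Ioo 0 t, ENNReal.ofReal (s ^ c) = ENNReal.ofReal (t ^ (c + 1) / (c + 1)) := by
  have integrable : IntervalIntegrable (fun x : ℝ => x ^ c) volume 0 t :=
    intervalIntegral.intervalIntegrable_rpow' hc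
  rw [intervalIntegrable_iff_integrableOn_Ioo_of_le ht] at integrable
  have nonneg : 0 ≤ᵐ[volume.restrict (Ioo 0 t)] fun s : ℝ => s ^ c := by
    filter_upwards [ae_restrict_mem measurableSet_Ioo] with s hs
    exact Real.rpow_nonneg hs.1.le _
  rw [← ofReal_integral_eq_lintegral_ofReal integrable nonneg, ← integral_Ioc_eq_integral_Ioo,
    ← intervalIntegral.integral_of_le ht, integral_rpow (Or.inl hc),
    Real.zero_rpow (by linarith), sub_zero]

lemma lintegral_sub_rpow {a t c : ℝ} (hat : a ≤ t) (hc : -1 < c) :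
    ∫⁻ s in Ioo a t, ENNReal.ofReal ((t - s) ^ c) =
      ENNReal.ofReal ((t - a) ^ (c + 1) / (c + 1)) := by
  rw [← lintegral_rpow_Ioo (sub_nonneg.2 hat) hc, ← lintegral_indicator measurableSet_Ioo,
    ← lintegral_indicator measurableSet_Ioo, ← lintegral_sub_left_eq_self _ t]
  refine lintegral_congr fun s => indicator_eq_indicator ?_ (by rw [sub_sub_cancel])
  simp only [mem_Ioo]
  constructor <;> rintro ⟨_, _⟩ <;> constructor <;> linarith

lemma half_rpow_neg_le {t e : ℝ} (ht : 0 < t) (he : e ≤ 1) : (t / 2) ^ (-e) ≤ 2 * t ^ (-e) := by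
  have two_rpow_le : (2 : ℝ) ^ e ≤ 2 := by
    simpa using Real.rpow_le_rpow_of_exponent_le one_le_two he
  calc (t / 2) ^ (-e) = 2 ^ e * t ^ (-e) := by
        rw [Real.div_rpow ht.le zero_le_two, Real.rpow_neg zero_le_two, div_inv_eq_mul, mul_comm]
    _ ≤ 2 * t ^ (-e) := by gcongr

lemma sub_rpow_mul_rpow_le {t s m e : ℝ} (hs : s ∈ Ioo 0 t) (hm : m ∈ Icc (0 : ℝ) 1)
    (he : e ∈ Icc (0 : ℝ) 1) :
    (t - s) ^ (m - 1) * s ^ (-e) ≤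
      2 * t ^ (m - 1) * s ^ (-e) + 2 * t ^ (-e) * (t - s) ^ (m - 1) := by
  have s_pos : 0 < s := hs.1
  have sub_pos : 0 < t - s := sub_pos.2 hs.2
  have t_pos : 0 < t := s_pos.trans hs.2
  rcases le_total s (t / 2) with early | late
  · have sub_rpow_le : (t - s) ^ (m - 1) ≤ 2 * t ^ (m - 1) :=
      (Real.rpow_le_rpow_of_nonpos (half_pos t_pos) (by linarith) (by linarith [hm.2])).trans
        (by simpa only [neg_sub] using half_rpow_neg_le t_pos (by linarith [hm.1] : 1 - m ≤ 1))
    exact (mul_le_mul_of_nonneg_right sub_rpow_le (by positivity)).trans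
      (le_add_of_nonneg_right (by positivity))
  · have rpow_le : s ^ (-e) ≤ 2 * t ^ (-e) :=
      (Real.rpow_le_rpow_of_nonpos (half_pos t_pos) late (by linarith [he.1])).trans
        (half_rpow_neg_le t_pos he.2)
    rw [mul_comm]
    exact (mul_le_mul_of_nonneg_right rpow_le (by positivity)).trans
      (le_add_of_nonneg_left (by positivity))

lemma lintegral_sub_rpow_mul_rpow_le {t m e : ℝ} (ht : 0 < t) (hm : m ∈ Ioc (0 : ℝ) 1)
    (he : e ∈ Ico (0 : ℝ) 1) :
    ∫⁻ s in Ioo 0 t, ENNReal.ofReal ((t - s) ^ (m - 1) * s ^ (-e)) ≤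
      ENNReal.ofReal (2 * (1 / (1 - e) + 1 / m) * t ^ (m - e)) := by
  have m_pos : 0 < m := hm.1
  have one_sub_pos : 0 < 1 - e := by linarith [he.2]
  calc ∫⁻ s in Ioo 0 t, ENNReal.ofReal ((t - s) ^ (m - 1) * s ^ (-e))
      ≤ ∫⁻ s in Ioo 0 t, (ENNReal.ofReal (2 * t ^ (m - 1)) * ENNReal.ofReal (s ^ (-e)) +
          ENNReal.ofReal (2 * t ^ (-e)) * ENNReal.ofReal ((t - s) ^ (m - 1))) := by
        refine setLIntegral_mono (by fun_prop) fun s hs => ?_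
        have rpow_pos := Real.rpow_pos_of_pos hs.1 (-e)
        have sub_rpow_pos := Real.rpow_pos_of_pos (sub_pos.2 hs.2) (m - 1)
        rw [← ENNReal.ofReal_mul (by positivity), ← ENNReal.ofReal_mul (by positivity),
          ← ENNReal.ofReal_add (by positivity) (by positivity)]
        exact ENNReal.ofReal_le_ofReal
          (sub_rpow_mul_rpow_le hs (Ioc_subset_Icc_self hm) (Ico_subset_Icc_self he))
    _ = ENNReal.ofReal (2 * t ^ (m - 1) * (t ^ (1 - e) / (1 - e)) +
          2 * t ^ (-e) * (t ^ m / m)) := by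
        rw [lintegral_add_left (by fun_prop), lintegral_const_mul _ (by fun_prop),
          lintegral_const_mul _ (by fun_prop), lintegral_rpow_Ioo ht.le (by linarith [he.2]),
          lintegral_sub_rpow ht.le (by linarith), ← ENNReal.ofReal_mul (by positivity),
          ← ENNReal.ofReal_mul (by positivity), sub_zero, neg_add_eq_sub, sub_add_cancel,
          ← ENNReal.ofReal_add (by positivity) (by positivity)]
    _ = ENNReal.ofReal (2 * (1 / (1 - e) + 1 / m) * t ^ (m - e)) := by
        have left_rpow : t ^ (m - e) = t ^ (m - 1) * t ^ (1 - e) := by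
          rw [← Real.rpow_add ht, sub_add_sub_cancel]
        have right_rpow : t ^ (m - e) = t ^ (-e) * t ^ m := by
          rw [← Real.rpow_add ht, neg_add_eq_sub]
        congr 1
        linear_combination -(2 / (1 - e)) * left_rpow - 2 / m * right_rpow

/-- An upper bound, uniform in `α`, for `α` times the Beta function
`B(α (1 - γ), 1 - α e)`. -/
noncomputable def betaBound (γ e : ℝ) : ℝ := 2 * (1 / (1 - e) + 1 / (1 - γ))

lemma betaBound_pos {γ e : ℝ} (hγ : γ < 1) (he : e < 1) : 0 < betaBound γ e :=
  mul_pos two_pos (add_pos (one_div_pos.2 (sub_pos.2 he)) (one_div_pos.2 (sub_pos.2 hγ)))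

lemma mul_beta_le_betaBound {α γ e : ℝ} (hα : α ∈ Ioo (0 : ℝ) 1) (hγ : γ ∈ Ico (0 : ℝ) 1)
    (he : e ∈ Ico (0 : ℝ) 1) :
    α * (2 * (1 / (1 - α * e) + 1 / (α * (1 - γ)))) ≤ betaBound γ e := by
  have α_pos : 0 < α := hα.1
  have one_sub_pos : 0 < 1 - e := sub_pos.2 he.2
  have one_sub_le : 1 - e ≤ 1 - α * e := by nlinarith [hα.2, he.1]
  calc α * (2 * (1 / (1 - α * e) + 1 / (α * (1 - γ))))
      = 2 * (α * (1 / (1 - α * e)) + 1 / (1 - γ)) := by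
        have := (sub_pos.2 hγ.2).ne'
        field_simp
    _ ≤ 2 * (1 * (1 / (1 - e)) + 1 / (1 - γ)) := by
        gcongr
        · exact (one_div_pos.2 (one_sub_pos.trans_le one_sub_le)).le
        · exact hα.2.le
    _ = betaBound γ e := by rw [one_mul, betaBound]

lemma lintegral_duhamel_weight_le {α γ e t : ℝ} (hα : α ∈ Ioo (0 : ℝ) 1)
    (hγ : γ ∈ Ico (0 : ℝ) 1) (he : e ∈ Ico (0 : ℝ) 1) (ht : 0 < t) :
    ENNReal.ofReal α * ∫⁻ s in Ioo 0 t, ENNReal.ofReal ((t - s) ^ (α - 1)) *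
      ENNReal.ofReal ((t - s) ^ (-(α * γ)) * s ^ (-(α * e))) ≤
    ENNReal.ofReal (betaBound γ e) * ENNReal.ofReal (t ^ (-(α * (γ + e - 1)))) := by
  have α_pos : 0 < α := hα.1
  have merge : EqOn (fun s => ENNReal.ofReal ((t - s) ^ (α - 1)) *
        ENNReal.ofReal ((t - s) ^ (-(α * γ)) * s ^ (-(α * e))))
      (fun s => ENNReal.ofReal ((t - s) ^ (α * (1 - γ) - 1) * s ^ (-(α * e)))) (Ioo 0 t) := by
    intro s hs
    have sub_pos : 0 < t - s := sub_pos.2 hs.2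
    beta_reduce
    rw [← ENNReal.ofReal_mul (by positivity), ← mul_assoc, ← Real.rpow_add sub_pos]
    ring_nf
  have hm : α * (1 - γ) ∈ Ioc (0 : ℝ) 1 :=
    ⟨mul_pos α_pos (sub_pos.2 hγ.2), by nlinarith [hα.2, hγ.1, hγ.2]⟩
  have hαe : α * e ∈ Ico (0 : ℝ) 1 :=
    ⟨mul_nonneg α_pos.le he.1, by nlinarith [hα.2, he.1, he.2]⟩
  have t_rpow : t ^ (α * (1 - γ) - α * e) = t ^ (-(α * (γ + e - 1))) := by ring_nf
  rw [setLIntegral_congr_fun measurableSet_Ioo merge]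
  refine (mul_le_mul_right (lintegral_sub_rpow_mul_rpow_le ht hm hαe) _).trans ?_
  rw [← ENNReal.ofReal_mul α_pos.le, ← ENNReal.ofReal_mul (betaBound_pos hγ.2 he.2).le,
    ← mul_assoc, t_rpow]
  gcongr
  exact mul_beta_le_betaBound hα hγ he

end TimeIntegrals

/-! ### Decay of the Duhamel operator -/

/-- The decay estimate `‖u(t)‖_{L^q} ≤ M t^{-β}` for all `t > 0`, raised to the power `q`. -/
def HasDecay (q β : ℝ) (M : ℝ≥0∞) (u : ℝ → Space N → ℝ≥0∞) : Prop :=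
  ∀ t, 0 < t → ∫⁻ x, u t x ^ q ≤ (M * ENNReal.ofReal (t ^ (-β))) ^ q

section Decay

variable {α p q β : ℝ} {M : ℝ≥0∞} {u : ℝ → Space N → ℝ≥0∞}

lemma HasDecay.mono {M' : ℝ≥0∞} (hu : HasDecay q β M u) (hq : 0 ≤ q) (hM : M ≤ M') :
    HasDecay q β M' u :=
  fun t ht => (hu t ht).trans (ENNReal.rpow_le_rpow (mul_le_mul_left hM _) hq)

lemma HasDecay.add {M' : ℝ≥0∞} {v : ℝ → Space N → ℝ≥0∞} (hq : 1 ≤ q)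
    (hu_meas : ∀ t, Measurable (u t)) (hv_meas : ∀ t, Measurable (v t))
    (hu : HasDecay q β M u) (hv : HasDecay q β M' v) :
    HasDecay q β (M + M') fun t x => u t x + v t x := by
  intro t ht
  have q_pos : 0 < q := by linarith
  have minkowski := ENNReal.lintegral_Lp_add_le (μ := volume)
    (hu_meas t).aemeasurable (hv_meas t).aemeasurable hq
  rw [one_div] at minkowski
  rw [← ENNReal.rpow_inv_le_iff q_pos, add_mul]
  exact minkowski.trans (add_le_add ((ENNReal.rpow_inv_le_iff q_pos).2 (hu t ht))
    ((ENNReal.rpow_inv_le_iff q_pos).2 (hv t ht)))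

lemma lintegral_subordinated_heat_rpow_le {r t : ℝ} (ht : 0 < t) (hr : 1 ≤ r) (hrq : r ≤ q)
    {a : ℝ → ℝ≥0∞} (ha : Measurable a) {f : Space N → ℝ≥0∞} (hf : Measurable f) {K : ℝ≥0∞}
    (hK : ∫⁻ θ in Ioi 0, a θ * ENNReal.ofReal (θ ^ (-smoothingExponent N r q)) ≤ K) :
    ∫⁻ x, (∫⁻ θ in Ioi 0, a θ * heat (t ^ α * θ) (volume.withDensity f) x) ^ q ≤
      (K * ENNReal.ofReal (t ^ (-(α * smoothingExponent N r q)))) ^ q *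
        (∫⁻ x, f x ^ r) ^ (q / r) := by
  set δ := smoothingExponent N r q
  have t_rpow_pos : 0 < t ^ α := Real.rpow_pos_of_pos ht α
  have weight_le : ∫⁻ θ in Ioi 0, a θ * ENNReal.ofReal ((t ^ α * θ) ^ (-δ)) ≤
      K * ENNReal.ofReal (t ^ (-(α * δ))) := by
    have split : EqOn (fun θ => a θ * ENNReal.ofReal ((t ^ α * θ) ^ (-δ)))
        (fun θ => a θ * ENNReal.ofReal (θ ^ (-δ)) * ENNReal.ofReal (t ^ (-(α * δ)))) (Ioi 0) := by
      intro θ (hθ : 0 < θ)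
      beta_reduce
      rw [Real.mul_rpow t_rpow_pos.le hθ.le, ← Real.rpow_mul ht.le, mul_comm (t ^ _), mul_neg,
        ENNReal.ofReal_mul (by positivity), mul_assoc]
    rw [setLIntegral_congr_fun measurableSet_Ioi split, lintegral_mul_const _ (by fun_prop)]
    exact mul_le_mul_left hK _
  refine (lintegral_rpow_lintegral_mul_le (hr.trans hrq) ha
    (F := fun θ x => heat (t ^ α * θ) (volume.withDensity f) x)
    (b := fun θ => ENNReal.ofReal ((t ^ α * θ) ^ (-δ))) (by fun_prop) ?_ (by simp)
    ((measurable_heat (volume.withDensity f)).comp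
      (f := fun z : ℝ × Space N => (t ^ α * z.1, z.2)) (by fun_prop)) ?_).trans
    (mul_le_mul_left (ENNReal.rpow_le_rpow weight_le (by linarith)) _)
  · filter_upwards [ae_restrict_mem measurableSet_Ioi] with θ (hθ : 0 < θ)
    exact (ENNReal.ofReal_pos.2 (by positivity)).ne'
  · filter_upwards [ae_restrict_mem measurableSet_Ioi] with θ (hθ : 0 < θ)
    exact lintegral_heat_rpow_le (mul_pos t_rpow_pos hθ) hr hrq hf

lemma hasDecay_opP {r : ℝ} (hr : 1 ≤ r) (hrq : r ≤ q) {K Λ : ℝ≥0∞}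
    (hK : ∫⁻ θ in Ioi 0, mittagDensity α θ * ENNReal.ofReal (θ ^ (-smoothingExponent N r q)) ≤ K)
    {f : Space N → ℝ≥0∞} (hf : Measurable f) (hfΛ : ∫⁻ x, f x ^ r ≤ Λ ^ r) :
    HasDecay q (α * smoothingExponent N r q) (K * Λ)
      fun t => opP α t (volume.withDensity f) := by
  intro t ht
  have r_pos : 0 < r := by linarith
  have q_nonneg : 0 ≤ q := by linarith
  calc ∫⁻ x, opP α t (volume.withDensity f) x ^ q
      ≤ (K * ENNReal.ofReal (t ^ (-(α * smoothingExponent N r q)))) ^ q *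
          (∫⁻ x, f x ^ r) ^ (q / r) :=
        lintegral_subordinated_heat_rpow_le ht hr hrq (measurable_mittagDensity α) hf hK
    _ ≤ (K * ENNReal.ofReal (t ^ (-(α * smoothingExponent N r q)))) ^ q *
          (Λ ^ r) ^ (q / r) := by gcongr
    _ = (K * Λ * ENNReal.ofReal (t ^ (-(α * smoothingExponent N r q)))) ^ q := by
        rw [← ENNReal.rpow_mul, mul_div_cancel₀ _ r_pos.ne',
          ← ENNReal.mul_rpow_of_nonneg _ _ q_nonneg, mul_right_comm]

lemma measurable_lintegral_mul {S X : Type*} [MeasurableSpace S] [MeasurableSpace X]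
    {ν : Measure S} [SFinite ν] {a : S → ℝ≥0∞} (ha : Measurable a) {F : S → X → ℝ≥0∞}
    (hF : Measurable (Function.uncurry F)) : Measurable fun x => ∫⁻ s, a s * F s x ∂ν :=
  ((ha.comp measurable_snd).mul (hF.comp measurable_swap) :
    Measurable fun z : X × S => a z.2 * F z.2 z.1).lintegral_prod_right'

lemma measurable_opS_sub_withDensity_rpow (hu : Measurable (Function.uncurry u)) (t : ℝ) :
    Measurable (Function.uncurry fun (s : ℝ) (x : Space N) =>
      opS α (t - s) (volume.withDensity fun y => u s y ^ p) x) :=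
  (measurable_opS_withDensity α (f := fun s y => u s y ^ p) (hu.pow_const p)).comp
    (f := fun z : ℝ × Space N => (t - z.1, z.1, z.2)) (by fun_prop)

lemma lintegral_opS_rpow_le {t δ s : ℝ} (hα : α ∈ Ioo (0 : ℝ) 1) (hp : 1 ≤ p) (hpq : p ≤ q)
    (hγ : smoothingExponent N (q / p) q ∈ Icc (0 : ℝ) 1) (hu_meas : Measurable (u s))
    (hu : HasDecay q (α * δ) M u) (hs : s ∈ Ioo 0 t) :
    ∫⁻ x, opS α (t - s) (volume.withDensity fun y => u s y ^ p) x ^ q ≤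
      ENNReal.ofReal ((t - s) ^ (-(α * smoothingExponent N (q / p) q)) *
        s ^ (-(α * (δ * p)))) ^ q * (5 * M ^ p) ^ q := by
  set γ := smoothingExponent N (q / p) q
  have s_pos : 0 < s := hs.1
  have sub_pos : 0 < t - s := sub_pos.2 hs.2
  have p_pos : 0 < p := by linarith
  have q_pos : 0 < q := by linarith
  have rpow_rpow (x : Space N) : (u s x ^ p) ^ (q / p) = u s x ^ q := by
    rw [← ENNReal.rpow_mul, mul_div_cancel₀ _ p_pos.ne']
  have decay_rpow : (M * ENNReal.ofReal (s ^ (-(α * δ)))) ^ p =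
      M ^ p * ENNReal.ofReal (s ^ (-(α * (δ * p)))) := by
    rw [ENNReal.mul_rpow_of_nonneg _ _ p_pos.le, ENNReal.ofReal_rpow_of_pos (by positivity),
      ← Real.rpow_mul s_pos.le, neg_mul, mul_assoc]
  calc ∫⁻ x, opS α (t - s) (volume.withDensity fun y => u s y ^ p) x ^ q
      ≤ (5 * ENNReal.ofReal ((t - s) ^ (-(α * γ)))) ^ q *
          (∫⁻ x, (u s x ^ p) ^ (q / p)) ^ (q / (q / p)) :=
        lintegral_subordinated_heat_rpow_le sub_pos ((one_le_div p_pos).2 hpq)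
          (div_le_self q_pos.le hp) (ENNReal.measurable_ofReal.mul (measurable_mittagDensity α))
          (hu_meas.pow_const p) (lintegral_mul_mittagDensity_mul_rpow_neg_le hα hγ)
    _ = (5 * ENNReal.ofReal ((t - s) ^ (-(α * γ)))) ^ q * (∫⁻ x, u s x ^ q) ^ p := by
        rw [lintegral_congr rpow_rpow, div_div_cancel₀ q_pos.ne']
    _ ≤ (5 * ENNReal.ofReal ((t - s) ^ (-(α * γ)))) ^ q *
          ((M * ENNReal.ofReal (s ^ (-(α * δ)))) ^ q) ^ p := by
        gcongr
        exact hu s s_pos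
    _ = ENNReal.ofReal ((t - s) ^ (-(α * γ)) * s ^ (-(α * (δ * p)))) ^ q *
          (5 * M ^ p) ^ q := by
        rw [← ENNReal.rpow_mul, mul_comm q p, ENNReal.rpow_mul, decay_rpow,
          ← ENNReal.mul_rpow_of_nonneg _ _ q_pos.le, ← ENNReal.mul_rpow_of_nonneg _ _ q_pos.le,
          ENNReal.ofReal_mul (by positivity)]
        ring_nf

lemma hasDecay_lintegral_opS {δ : ℝ} (hα : α ∈ Ioo (0 : ℝ) 1) (hp : 1 ≤ p) (hpq : p ≤ q)
    (hγ : smoothingExponent N (q / p) q ∈ Ico (0 : ℝ) 1) (hδ : δ * p ∈ Ico (0 : ℝ) 1)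
    (hu_meas : Measurable (Function.uncurry u)) (hu : HasDecay q (α * δ) M u) :
    HasDecay q (α * (smoothingExponent N (q / p) q + δ * p - 1))
      (ENNReal.ofReal (betaBound (smoothingExponent N (q / p) q) (δ * p)) * (5 * M ^ p))
      fun t x => ENNReal.ofReal α * ∫⁻ s in Ioo 0 t, ENNReal.ofReal ((t - s) ^ (α - 1)) *
        opS α (t - s) (volume.withDensity fun y => u s y ^ p) x := by
  intro t ht
  set γ := smoothingExponent N (q / p) q
  set weight := ∫⁻ s in Ioo 0 t, ENNReal.ofReal ((t - s) ^ (α - 1)) *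
    ENNReal.ofReal ((t - s) ^ (-(α * γ)) * s ^ (-(α * (δ * p))))
  have q_nonneg : 0 ≤ q := by linarith
  have minkowski : ∫⁻ x, (∫⁻ s in Ioo 0 t, ENNReal.ofReal ((t - s) ^ (α - 1)) *
      opS α (t - s) (volume.withDensity fun y => u s y ^ p) x) ^ q ≤
        weight ^ q * (5 * M ^ p) ^ q := by
    refine lintegral_rpow_lintegral_mul_le (hp.trans hpq) (by fun_prop)
      (b := fun s => ENNReal.ofReal ((t - s) ^ (-(α * γ)) * s ^ (-(α * (δ * p))))) (by fun_prop)
      ?_ (by simp) (measurable_opS_sub_withDensity_rpow hu_meas t) ?_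
    · filter_upwards [ae_restrict_mem measurableSet_Ioo] with s hs
      exact (ENNReal.ofReal_pos.2 (mul_pos (Real.rpow_pos_of_pos (sub_pos.2 hs.2) _)
        (Real.rpow_pos_of_pos hs.1 _))).ne'
    · filter_upwards [ae_restrict_mem measurableSet_Ioo] with s hs
      exact lintegral_opS_rpow_le hα hp hpq (Ico_subset_Icc_self hγ)
        (hu_meas.comp measurable_prodMk_left) hu hs
  simp_rw [ENNReal.mul_rpow_of_nonneg (ENNReal.ofReal α) _ q_nonneg]
  rw [lintegral_const_mul' _ _ (ENNReal.rpow_ne_top_of_nonneg q_nonneg ENNReal.ofReal_ne_top)]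
  calc ENNReal.ofReal α ^ q * _
      ≤ ENNReal.ofReal α ^ q * (weight ^ q * (5 * M ^ p) ^ q) := mul_le_mul_right minkowski _
    _ = (ENNReal.ofReal α * weight * (5 * M ^ p)) ^ q := by
        rw [ENNReal.mul_rpow_of_nonneg (_ * weight) _ q_nonneg,
          ENNReal.mul_rpow_of_nonneg _ weight q_nonneg, mul_assoc]
    _ ≤ (ENNReal.ofReal (betaBound γ (δ * p)) * ENNReal.ofReal (t ^ (-(α * (γ + δ * p - 1)))) *
          (5 * M ^ p)) ^ q :=
        ENNReal.rpow_le_rpow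
          (mul_le_mul_left (lintegral_duhamel_weight_le hα hγ hδ ht) _) q_nonneg
    _ = _ := by rw [mul_right_comm]

end Decay

/-! ### Small data in the scaling critical Lebesgue space -/

/-- The exponent `r = N (p - 1) / 2` whose Lebesgue norm is invariant under the scaling of the
equation. -/
noncomputable def criticalExponent (N : ℕ) (p : ℝ) : ℝ := (N : ℝ) * (p - 1) / 2

/-- The exponents `q` for which solutions with small data in the critical Lebesgue space decay in
`L^q`: both the singularity of `S_α(t - s)` from `L^{q/p}` to `L^q` and that of `u(s)^p` at `s = 0`
are then integrable in time. -/
structure IsAdmissibleExponent (N : ℕ) (p q : ℝ) : Prop where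
  one_lt : 1 < p
  one_lt_criticalExponent : 1 < criticalExponent N p
  lt : p < q
  criticalExponent_lt : criticalExponent N p < q
  lt_mul : q < p * criticalExponent N p

/-- The rate `δ` at which the semigroup maps the critical Lebesgue space to `L^q`. -/
noncomputable def decayExponent (N : ℕ) (p q : ℝ) : ℝ :=
  smoothingExponent N (criticalExponent N p) q

namespace IsAdmissibleExponent

variable {p q : ℝ}

lemma pos (h : IsAdmissibleExponent N p q) : 0 < q := by linarith [h.one_lt, h.lt]

lemma smoothingExponent_eq (h : IsAdmissibleExponent N p q) :
    smoothingExponent N (q / p) q = criticalExponent N p / q := by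
  have := h.pos.ne'
  rw [smoothingExponent, criticalExponent]
  field_simp

lemma smoothingExponent_mem (h : IsAdmissibleExponent N p q) :
    smoothingExponent N (q / p) q ∈ Ico (0 : ℝ) 1 := by
  have critical_pos : 0 < criticalExponent N p := by linarith [h.one_lt_criticalExponent]
  rw [h.smoothingExponent_eq]
  exact ⟨(div_pos critical_pos h.pos).le, (div_lt_one h.pos).2 h.criticalExponent_lt⟩

lemma decayExponent_mul_sub_one (h : IsAdmissibleExponent N p q) :
    decayExponent N p q * (p - 1) = 1 - smoothingExponent N (q / p) q := by
  have critical_ne : (N : ℝ) * (p - 1) / 2 ≠ 0 :=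
    (zero_lt_one.trans h.one_lt_criticalExponent).ne'
  have N_ne : (N : ℝ) ≠ 0 := by rintro hN; simp [hN] at critical_ne
  have p_sub_one_ne : p - 1 ≠ 0 := (sub_pos.2 h.one_lt).ne'
  have q_ne := h.pos.ne'
  rw [h.smoothingExponent_eq, decayExponent, smoothingExponent, criticalExponent]
  field_simp

lemma smoothingExponent_add_sub_one (h : IsAdmissibleExponent N p q) :
    smoothingExponent N (q / p) q + decayExponent N p q * p - 1 = decayExponent N p q := by
  linear_combination h.decayExponent_mul_sub_one

lemma decayExponent_pos (h : IsAdmissibleExponent N p q) : 0 < decayExponent N p q := by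
  have mul_pos : 0 < decayExponent N p q * (p - 1) := by
    linarith [h.decayExponent_mul_sub_one, h.smoothingExponent_mem.2]
  exact pos_of_mul_pos_left mul_pos (sub_pos.2 h.one_lt).le

lemma decayExponent_mul_mem (h : IsAdmissibleExponent N p q) :
    decayExponent N p q * p ∈ Ico (0 : ℝ) 1 := by
  have p_pos : 0 < p := zero_lt_one.trans h.one_lt
  have one_lt_mul : 1 < p * smoothingExponent N (q / p) q := by
    rw [h.smoothingExponent_eq, ← mul_div_assoc, one_lt_div h.pos]
    exact h.lt_mul
  refine ⟨(mul_pos h.decayExponent_pos p_pos).le, ?_⟩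
  have : decayExponent N p q * p * (p - 1) < 1 * (p - 1) := by
    linear_combination p * h.decayExponent_mul_sub_one + one_lt_mul
  exact lt_of_mul_lt_mul_right this (sub_pos.2 h.one_lt).le

lemma decayExponent_mem (h : IsAdmissibleExponent N p q) :
    decayExponent N p q ∈ Ico (0 : ℝ) 1 :=
  ⟨h.decayExponent_pos.le,
    (le_mul_of_one_le_right h.decayExponent_pos.le h.one_lt.le).trans_lt h.decayExponent_mul_mem.2⟩

end IsAdmissibleExponent

lemma one_lt_of_fujitaExponent_lt {p : ℝ} (hp : fujitaExponent N < p) : 1 < p :=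
  (le_add_of_nonneg_right (by positivity)).trans_lt hp

lemma one_lt_criticalExponent (hN : 1 ≤ N) {p : ℝ} (hp : fujitaExponent N < p) :
    1 < criticalExponent N p := by
  have N_pos : (0 : ℝ) < N := by exact_mod_cast hN
  have two_div_lt : 2 / (N : ℝ) < p - 1 := by
    rw [fujitaExponent] at hp
    linarith
  rw [div_lt_iff₀ N_pos] at two_div_lt
  rw [criticalExponent]
  linarith

lemma exists_isAdmissibleExponent (hN : 1 ≤ N) {p : ℝ} (hp : fujitaExponent N < p) :
    ∃ q, IsAdmissibleExponent N p q := by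
  have one_lt := one_lt_of_fujitaExponent_lt hp
  have one_lt_critical := one_lt_criticalExponent hN hp
  obtain ⟨q, max_lt, lt_mul⟩ :
      ∃ q, max p (criticalExponent N p) < q ∧ q < p * criticalExponent N p :=
    exists_between (max_lt (by nlinarith) (by nlinarith))
  exact ⟨q, one_lt, one_lt_critical, (le_max_left _ _).trans_lt max_lt,
    (le_max_right _ _).trans_lt max_lt, lt_mul⟩

/-- The factor in front of `M ^ p` in the decay estimate of the Duhamel operator: `5` bounds the
moments of `θ h_α(θ)` and `betaBound` the integral in time. -/
noncomputable def duhamelConst (N : ℕ) (p q : ℝ) : ℝ :=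
  betaBound (smoothingExponent N (q / p) q) (decayExponent N p q * p) * 5

lemma IsAdmissibleExponent.duhamelConst_pos {p q : ℝ} (h : IsAdmissibleExponent N p q) :
    0 < duhamelConst N p q :=
  mul_pos (betaBound_pos h.smoothingExponent_mem.2 h.decayExponent_mul_mem.2) (by norm_num)

section SmallData

variable {α p q : ℝ} {f : Space N → ℝ≥0∞}

lemma HasDecay.duhamel (h : IsAdmissibleExponent N p q) (hα : α ∈ Ioo (0 : ℝ) 1) {K Λ M : ℝ≥0∞}
    (hK : ∫⁻ θ in Ioi 0, mittagDensity α θ * ENNReal.ofReal (θ ^ (-decayExponent N p q)) ≤ K)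
    (hf : Measurable f)
    (hfΛ : ∫⁻ x, f x ^ criticalExponent N p ≤ Λ ^ criticalExponent N p)
    {u : ℝ → Space N → ℝ≥0∞} (hu_meas : Measurable (Function.uncurry u))
    (hu : HasDecay q (α * decayExponent N p q) M u) :
    HasDecay q (α * decayExponent N p q) (K * Λ + ENNReal.ofReal (duhamelConst N p q) * M ^ p)
      (FracFujita.duhamel α p (volume.withDensity f) u) := by
  have decay_opS := hasDecay_lintegral_opS hα h.one_lt.le h.lt.le h.smoothingExponent_mem
    h.decayExponent_mul_mem hu_meas hu
  rw [h.smoothingExponent_add_sub_one, ← mul_assoc,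
    show (5 : ℝ≥0∞) = ENNReal.ofReal 5 by norm_num, ← ENNReal.ofReal_mul' (by norm_num)]
    at decay_opS
  refine HasDecay.add (h.one_lt.trans h.lt).le (fun t => ?_) (fun t => ?_)
    (hasDecay_opP h.one_lt_criticalExponent.le h.criticalExponent_lt.le hK hf hfΛ) decay_opS
  · exact (measurable_opP α (volume.withDensity f)).comp
      (f := fun x : Space N => (t, x)) (by fun_prop)
  · exact (measurable_lintegral_mul (by fun_prop)
      (measurable_opS_sub_withDensity_rpow hu_meas t)).const_mul _

lemma exists_pos_mul_add_mul_rpow_le (K : ℝ) {D : ℝ} (hD : 0 < D) (hp : 1 < p) :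
    ∃ M ε : ℝ, 0 < M ∧ 0 < ε ∧ K * ε + D * M ^ p ≤ M := by
  have p_sub_one_pos : 0 < p - 1 := sub_pos.2 hp
  set M : ℝ := (1 / (2 * D)) ^ (p - 1)⁻¹ with M_def
  have M_pos : 0 < M := by positivity
  have M_rpow : M ^ p = 1 / (2 * D) * M := by
    rw [← Real.rpow_inv_rpow (by positivity : 0 ≤ 1 / (2 * D)) p_sub_one_pos.ne', ← M_def,
      ← Real.rpow_add_one M_pos.ne', sub_add_cancel]
  have denominator_pos : 0 < 2 * (|K| + 1) := by positivity
  refine ⟨M, M / (2 * (|K| + 1)), M_pos, by positivity, ?_⟩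
  have linear_le : K * (M / (2 * (|K| + 1))) ≤ M / 2 := by
    rw [← mul_div_assoc, div_le_div_iff₀ denominator_pos two_pos]
    nlinarith [le_abs_self K]
  have power_eq : D * M ^ p = M / 2 := by
    rw [M_rpow]
    field_simp
  linarith

lemma hasDecay_picard (h : IsAdmissibleExponent N p q) (hα : α ∈ Ioo (0 : ℝ) 1) {K Λ M : ℝ≥0∞}
    (hK : ∫⁻ θ in Ioi 0, mittagDensity α θ * ENNReal.ofReal (θ ^ (-decayExponent N p q)) ≤ K)
    (hf : Measurable f)
    (hfΛ : ∫⁻ x, f x ^ criticalExponent N p ≤ Λ ^ criticalExponent N p)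
    (hM : K * Λ + ENNReal.ofReal (duhamelConst N p q) * M ^ p ≤ M) (n : ℕ) :
    HasDecay q (α * decayExponent N p q) M (picard α p (volume.withDensity f) n) := by
  induction n with
  | zero =>
    intro t _
    simp [picard, ENNReal.zero_rpow_of_pos h.pos]
  | succ n ih =>
    exact (ih.duhamel h hα hK hf hfΛ (measurable_picard α p _ n)).mono h.pos.le hM

lemma ae_picardLimit_lt_top {β : ℝ} (hq : 0 < q) (hp : 0 ≤ p) {μ : Measure (Space N)}
    [SFinite μ] {M : ℝ≥0∞} (hM : M ≠ ∞) (h : ∀ n, HasDecay q β M (picard α p μ n)) (T : ℝ) :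
    ∀ᵐ z ∂(slab N T), picardLimit α p μ z.1 z.2 < ∞ := by
  have measurableSet_lt_top : MeasurableSet {z | Function.uncurry (picardLimit α p μ) z < ∞} :=
    measurableSet_lt (measurable_picardLimit α p μ) measurable_const
  refine (Measure.ae_prod_iff_ae_ae measurableSet_lt_top).2 ?_
  filter_upwards [ae_restrict_mem measurableSet_Ioc] with t ht
  have rpow_picardLimit (x : Space N) :
      picardLimit α p μ t x ^ q = ⨆ n, picard α p μ n t x ^ q :=
    (ENNReal.orderIsoRpow q hq).map_iSup _
  have measurable_rpow (n : ℕ) : Measurable fun x => picard α p μ n t x ^ q :=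
    ((measurable_picard α p μ n).comp measurable_prodMk_left).pow_const q
  have lintegral_le :
      ∫⁻ x, picardLimit α p μ t x ^ q ≤ (M * ENNReal.ofReal (t ^ (-β))) ^ q := by
    simp_rw [rpow_picardLimit]
    rw [lintegral_iSup measurable_rpow
      fun m n hmn x => ENNReal.rpow_le_rpow (monotone_picard hp α μ t x hmn) hq.le]
    exact iSup_le fun n => h n t ht.1
  have lintegral_ne_top : ∫⁻ x, picardLimit α p μ t x ^ q ≠ ∞ :=
    ne_top_of_le_ne_top (ENNReal.rpow_ne_top_of_nonneg hq.le
      (ENNReal.mul_ne_top hM ENNReal.ofReal_ne_top)) lintegral_le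
  filter_upwards [ae_lt_top
    (((measurable_picardLimit α p μ).comp measurable_prodMk_left).pow_const q)
    lintegral_ne_top] with x hx
  exact (ENNReal.rpow_lt_top_iff_of_pos hq).1 hx

lemma exists_hasGlobalSolution_of_small (hN : 1 ≤ N) (hp : fujitaExponent N < p) :
    ∃ ε : ℝ, 0 < ε ∧ ∀ α ∈ Ioo (0 : ℝ) 1, ∀ f : Space N → ℝ≥0∞, Measurable f →
      ∫⁻ x, f x ^ criticalExponent N p ≤ ENNReal.ofReal ε ^ criticalExponent N p →
      HasGlobalSolution α p (volume.withDensity f) := by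
  obtain ⟨q, hq⟩ := exists_isAdmissibleExponent hN hp
  obtain ⟨K, K_lt_top, hK⟩ := exists_lintegral_mittagDensity_mul_rpow_neg_le hq.decayExponent_mem
  have p_pos : 0 < p := zero_lt_one.trans hq.one_lt
  have D_pos := hq.duhamelConst_pos
  obtain ⟨M, ε, M_pos, ε_pos, small⟩ :=
    exists_pos_mul_add_mul_rpow_le K.toReal D_pos hq.one_lt
  have small_ofReal : K * ENNReal.ofReal ε +
      ENNReal.ofReal (duhamelConst N p q) * ENNReal.ofReal M ^ p ≤ ENNReal.ofReal M := by
    rw [← ENNReal.ofReal_toReal K_lt_top.ne, ENNReal.ofReal_rpow_of_pos M_pos,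
      ← ENNReal.ofReal_mul ENNReal.toReal_nonneg, ← ENNReal.ofReal_mul D_pos.le,
      ← ENNReal.ofReal_add (by positivity) (by positivity)]
    exact ENNReal.ofReal_le_ofReal small
  refine ⟨ε, ε_pos, fun α hα f hf hfε => ?_⟩
  rw [hasGlobalSolution_iff_picardLimit_lt_top p_pos]
  exact fun T _ => ae_picardLimit_lt_top hq.pos p_pos.le ENNReal.ofReal_ne_top
    (hasDecay_picard hq hα (hK α hα) hf hfε small_ofReal) T

end SmallData

/-! ### Blow-up of solutions with large data on a ball -/

/-- A lower bound, depending on the dimension only, of `P_α(t) χ_B` on a ball `B` of radius `r` for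
`t^α ≤ r²`. -/
noncomputable def ballBound (N : ℕ) : ℝ := 2 / 3 * Real.exp (-2) * ballHeatBound N

lemma ballBound_pos (N : ℕ) : 0 < ballBound N :=
  mul_pos (mul_pos (by norm_num) (Real.exp_pos _)) (ballHeatBound_pos N)

section LowerBounds

variable {α p t r : ℝ} {c x : Space N}

lemma measurable_heat_mul_left (s : ℝ) (μ : Measure (Space N)) [SFinite μ] (x : Space N) :
    Measurable fun θ : ℝ => heat (s * θ) μ x :=
  (measurable_heat μ).comp (f := fun θ : ℝ => (s * θ, x)) (by fun_prop)

lemma ballHeatBound_mul_le_heat_rpow_mul (hr : 0 < r) (ht : 0 < t) (htr : t ^ α ≤ r ^ 2) {θ : ℝ}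
    (hθ : θ ∈ Icc (1 / 2 : ℝ) 4) (hx : x ∈ Metric.closedBall c r) {f : Space N → ℝ≥0∞}
    (hf : Measurable f) {a : ℝ≥0∞} (ha : ∀ y ∈ Metric.ball c r, a ≤ f y) :
    ENNReal.ofReal (ballHeatBound N) * a ≤ heat (t ^ α * θ) (volume.withDensity f) x := by
  have θ_pos : 0 < θ := by linarith [hθ.1]
  refine ballHeatBound_mul_le_heat hr (mul_pos (Real.rpow_pos_of_pos ht α) θ_pos) ?_ hx hf ha
  rw [mul_comm (4 : ℝ)]
  exact mul_le_mul htr hθ.2 θ_pos.le (by positivity)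

lemma ballBound_mul_le_opP (hα : α ∈ Ioo (0 : ℝ) 1) (hr : 0 < r) (ht : 0 < t)
    (htr : t ^ α ≤ r ^ 2) (hx : x ∈ Metric.closedBall c r) {f : Space N → ℝ≥0∞}
    (hf : Measurable f) {a : ℝ≥0∞} (ha : ∀ y ∈ Metric.ball c r, a ≤ f y) :
    ENNReal.ofReal (ballBound N) * a ≤ opP α t (volume.withDensity f) x := by
  rw [ballBound, ENNReal.ofReal_mul (by positivity), mul_assoc]
  exact le_lintegral_mittagDensity_mul hα (measurable_heat_mul_left _ _ x)
    fun θ hθ => ballHeatBound_mul_le_heat_rpow_mul hr ht htr hθ hx hf ha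

lemma ballBound_mul_le_opS (hα : α ∈ Ioo (0 : ℝ) 1) (hr : 0 < r) (ht : 0 < t)
    (htr : t ^ α ≤ r ^ 2) (hx : x ∈ Metric.closedBall c r) {f : Space N → ℝ≥0∞}
    (hf : Measurable f) {a : ℝ≥0∞} (ha : ∀ y ∈ Metric.ball c r, a ≤ f y) :
    ENNReal.ofReal (ballBound N / 2) * a ≤ opS α t (volume.withDensity f) x := by
  have half_le : ∀ θ ∈ Icc (1 / 2 : ℝ) 4, ENNReal.ofReal (1 / 2) *
      (ENNReal.ofReal (ballHeatBound N) * a) ≤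
        ENNReal.ofReal θ * heat (t ^ α * θ) (volume.withDensity f) x := fun θ hθ =>
    mul_le_mul' (ENNReal.ofReal_le_ofReal hθ.1)
      (ballHeatBound_mul_le_heat_rpow_mul hr ht htr hθ hx hf ha)
  calc ENNReal.ofReal (ballBound N / 2) * a
      = ENNReal.ofReal (2 / 3 * Real.exp (-2)) *
          (ENNReal.ofReal (1 / 2) * (ENNReal.ofReal (ballHeatBound N) * a)) := by
        rw [← mul_assoc, ← mul_assoc, ← ENNReal.ofReal_mul (by positivity),
          ← ENNReal.ofReal_mul (by positivity), ballBound]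
        ring_nf
    _ ≤ ∫⁻ θ in Ioi 0, mittagDensity α θ *
          (ENNReal.ofReal θ * heat (t ^ α * θ) (volume.withDensity f) x) :=
        le_lintegral_mittagDensity_mul hα
          (ENNReal.measurable_ofReal.mul (measurable_heat_mul_left _ _ x)) half_le
    _ = opS α t (volume.withDensity f) x := lintegral_congr fun θ => by ring

lemma ofReal_mul_lintegral_sub_rpow {a : ℝ} (hα : 0 < α) (hat : a ≤ t) :
    ENNReal.ofReal α * ∫⁻ s in Ioo a t, ENNReal.ofReal ((t - s) ^ (α - 1)) =
      ENNReal.ofReal ((t - a) ^ α) := by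
  rw [lintegral_sub_rpow hat (by linarith), sub_add_cancel, ← ENNReal.ofReal_mul hα.le,
    mul_div_cancel₀ _ hα.ne']

lemma rpow_mul_le_duhamel {T t₀ : ℝ} (hα : α ∈ Ioo (0 : ℝ) 1) (hp : 0 ≤ p) (hr : 0 < r)
    (hTr : T ^ α ≤ r ^ 2) (ht₀ : 0 ≤ t₀) (ht : t ∈ Ioc t₀ T) (hx : x ∈ Metric.closedBall c r)
    (μ : Measure (Space N)) {u : ℝ → Space N → ℝ≥0∞} (hu : Measurable (Function.uncurry u))
    {a : ℝ≥0∞} (ha : ∀ s ∈ Ioc t₀ T, ∀ y ∈ Metric.ball c r, a ≤ u s y) :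
    ENNReal.ofReal ((t - t₀) ^ α) * (ENNReal.ofReal (ballBound N / 2) * a ^ p) ≤
      duhamel α p μ u t x := by
  have le_opS : ∀ s ∈ Ioo t₀ t, ENNReal.ofReal (ballBound N / 2) * a ^ p ≤
      opS α (t - s) (volume.withDensity fun y => u s y ^ p) x := by
    intro s hs
    have sub_rpow_le : (t - s) ^ α ≤ T ^ α :=
      Real.rpow_le_rpow (sub_nonneg.2 hs.2.le) (by linarith [hs.1, ht.2]) hα.1.le
    exact ballBound_mul_le_opS hα hr (sub_pos.2 hs.2) (sub_rpow_le.trans hTr) hx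
      ((hu.comp measurable_prodMk_left).pow_const p)
      fun y hy => ENNReal.rpow_le_rpow (ha s ⟨hs.1, hs.2.le.trans ht.2⟩ y hy) hp
  calc ENNReal.ofReal ((t - t₀) ^ α) * (ENNReal.ofReal (ballBound N / 2) * a ^ p)
      = ENNReal.ofReal α * ∫⁻ s in Ioo t₀ t, ENNReal.ofReal ((t - s) ^ (α - 1)) *
          (ENNReal.ofReal (ballBound N / 2) * a ^ p) := by
        rw [lintegral_mul_const _ (by fun_prop), ← mul_assoc (ENNReal.ofReal α),
          ofReal_mul_lintegral_sub_rpow hα.1 ht.1.le]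
    _ ≤ ENNReal.ofReal α * ∫⁻ s in Ioo t₀ t, ENNReal.ofReal ((t - s) ^ (α - 1)) *
          opS α (t - s) (volume.withDensity fun y => u s y ^ p) x :=
        mul_le_mul_right (setLIntegral_mono' measurableSet_Ioo fun s hs =>
          mul_le_mul_right (le_opS s hs) _) _
    _ ≤ ENNReal.ofReal α * ∫⁻ s in Ioo 0 t, ENNReal.ofReal ((t - s) ^ (α - 1)) *
          opS α (t - s) (volume.withDensity fun y => u s y ^ p) x :=
        mul_le_mul_right (lintegral_mono_set (Ioo_subset_Ioo_left ht₀)) _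
    _ ≤ duhamel α p μ u t x := le_add_self

end LowerBounds

/-- The ratio of the geometric growth of the solution; its power `p - 1` is `2`, which makes up for
the halving of the time intervals. -/
noncomputable def growthRatio (p : ℝ) : ℝ := 2 ^ (p - 1)⁻¹

lemma one_lt_growthRatio {p : ℝ} (hp : 1 < p) : 1 < growthRatio p :=
  Real.one_lt_rpow one_lt_two (inv_pos.2 (sub_pos.2 hp))

lemma growthRatio_rpow {p : ℝ} (hp : 1 < p) : growthRatio p ^ p = 2 * growthRatio p := by
  have ratio_pos : 0 < growthRatio p := zero_lt_one.trans (one_lt_growthRatio hp)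
  calc growthRatio p ^ p = growthRatio p ^ (p - 1) * growthRatio p := by
        rw [← Real.rpow_add_one ratio_pos.ne', sub_add_cancel]
    _ = 2 * growthRatio p := by
        rw [growthRatio, Real.rpow_inv_rpow zero_le_two (sub_pos.2 hp).ne']

/-- The constant in the necessary condition `min_rpow_sq_mul_rpow_le_blowupConst` for
solvability. -/
noncomputable def blowupConst (N : ℕ) (p : ℝ) : ℝ := 8 * growthRatio p / ballBound N ^ p

lemma blowupConst_pos (N : ℕ) (p : ℝ) : 0 < blowupConst N p := by
  have := ballBound_pos N
  unfold blowupConst growthRatio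
  positivity

/-- The left end of the `n`-th time interval `(T/2 (1 - 2^{-n}), T]`, on which the `n`-th lower
bound of the solution holds. -/
noncomputable def levelTime (T : ℝ) (n : ℕ) : ℝ := T / 2 * (1 - (1 / 2) ^ n)

lemma levelTime_zero (T : ℝ) : levelTime T 0 = 0 := by simp [levelTime]

lemma levelTime_succ (T : ℝ) (n : ℕ) :
    levelTime T (n + 1) = levelTime T n + T * (1 / 2) ^ (n + 2) := by
  unfold levelTime
  ring

lemma levelTime_nonneg {T : ℝ} (hT : 0 ≤ T) (n : ℕ) : 0 ≤ levelTime T n :=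
  mul_nonneg (by positivity) (sub_nonneg.2 (pow_le_one₀ (by norm_num) (by norm_num)))

lemma levelTime_le_half {T : ℝ} (hT : 0 ≤ T) (n : ℕ) : levelTime T n ≤ T / 2 :=
  mul_le_of_le_one_right (by positivity) (sub_le_self _ (by positivity))

lemma rpow_mul_half_pow_le_rpow_sub_levelTime {α T t : ℝ} (hα : α ∈ Icc (0 : ℝ) 1) (hT : 0 ≤ T)
    {n : ℕ} (ht : levelTime T (n + 1) ≤ t) :
    T ^ α * (1 / 2) ^ (n + 2) ≤ (t - levelTime T n) ^ α := by
  have half_pow_le : (1 / 2 : ℝ) ^ (n + 2) ≤ ((1 / 2) ^ (n + 2)) ^ α :=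
    Real.self_le_rpow_of_le_one (by positivity) (pow_le_one₀ (by norm_num) (by norm_num)) hα.2
  calc T ^ α * (1 / 2) ^ (n + 2) ≤ T ^ α * ((1 / 2) ^ (n + 2)) ^ α := by gcongr
    _ = (T * (1 / 2) ^ (n + 2)) ^ α := (Real.mul_rpow hT (by positivity)).symm
    _ ≤ (t - levelTime T n) ^ α := by
        rw [levelTime_succ] at ht
        exact Real.rpow_le_rpow (by positivity) (by linarith) hα.1

lemma mul_growthRatio_pow_succ_le {b A p τ d : ℝ} (hb : 0 < b) (hA : 0 < A) (hp : 1 < p)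
    (h : 8 * growthRatio p / b ^ p ≤ τ * A ^ (p - 1)) {n : ℕ} (hd : τ * (1 / 2) ^ (n + 2) ≤ d) :
    b * A * growthRatio p ^ (n + 1) ≤ d * (b / 2 * (b * A * growthRatio p ^ n) ^ p) := by
  have ratio_pos : 0 < growthRatio p := zero_lt_one.trans (one_lt_growthRatio hp)
  have b_rpow_pos : 0 < b ^ p := Real.rpow_pos_of_pos hb p
  rw [div_le_iff₀ b_rpow_pos] at h
  have A_rpow : A ^ p = A ^ (p - 1) * A := by rw [← Real.rpow_add_one hA.ne', sub_add_cancel]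
  have ratio_rpow : (growthRatio p ^ n) ^ p = 2 ^ n * growthRatio p ^ n := by
    rw [← Real.rpow_pow_comm ratio_pos.le, growthRatio_rpow hp, mul_pow]
  have half_pow_mul : (1 / 2 : ℝ) ^ (n + 2) * 2 ^ n = 1 / 4 := by
    rw [pow_add, mul_right_comm, ← mul_pow]
    norm_num
  calc b * A * growthRatio p ^ (n + 1)
      = b * A * growthRatio p ^ n / 8 * (8 * growthRatio p) := by ring
    _ ≤ b * A * growthRatio p ^ n / 8 * (τ * A ^ (p - 1) * b ^ p) := by gcongr
    _ = τ * (1 / 2) ^ (n + 2) * (b / 2 * (b * A * growthRatio p ^ n) ^ p) := by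
        rw [Real.mul_rpow (by positivity) (by positivity), Real.mul_rpow hb.le hA.le, A_rpow,
          ratio_rpow]
        linear_combination
          -(τ * (b / 2) * b ^ p * A ^ (p - 1) * A * growthRatio p ^ n) * half_pow_mul
    _ ≤ d * (b / 2 * (b * A * growthRatio p ^ n) ^ p) := by gcongr

section Necessary

variable {α p T r A : ℝ} {c : Space N} {f : Space N → ℝ≥0∞}

lemma ballBound_mul_growthRatio_pow_le_picardLimit (hα : α ∈ Ioo (0 : ℝ) 1) (hp : 1 < p)
    (hr : 0 < r) (hT : 0 < T) (hTr : T ^ α ≤ r ^ 2) (hA : 0 < A) (hf : Measurable f)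
    (hfA : ∀ y ∈ Metric.ball c r, ENNReal.ofReal A ≤ f y)
    (hlarge : blowupConst N p ≤ T ^ α * A ^ (p - 1)) (n : ℕ) :
    ∀ t ∈ Ioc (levelTime T n) T, ∀ x ∈ Metric.ball c r,
      ENNReal.ofReal (ballBound N * A * growthRatio p ^ n) ≤
        picardLimit α p (volume.withDensity f) t x := by
  have ballBound_pos := ballBound_pos N
  have ratio_pos : 0 < growthRatio p := zero_lt_one.trans (one_lt_growthRatio hp)
  have p_pos : 0 < p := zero_lt_one.trans hp
  induction n with
  | zero =>
    intro t ht x hx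
    have t_pos : 0 < t := levelTime_zero T ▸ ht.1
    rw [← duhamel_picardLimit α p_pos _ t x, pow_zero, mul_one,
      ENNReal.ofReal_mul ballBound_pos.le]
    exact (ballBound_mul_le_opP hα hr t_pos
      ((Real.rpow_le_rpow t_pos.le ht.2 hα.1.le).trans hTr)
      (Metric.ball_subset_closedBall hx) hf hfA).trans le_self_add
  | succ n ih =>
    intro t ht x hx
    have levelTime_lt : levelTime T n < t := by
      refine lt_trans ?_ ht.1
      rw [levelTime_succ]
      exact lt_add_of_pos_right _ (by positivity)
    rw [← duhamel_picardLimit α p_pos _ t x]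
    refine le_trans ?_ (rpow_mul_le_duhamel hα p_pos.le hr hTr (levelTime_nonneg hT.le n)
      ⟨levelTime_lt, ht.2⟩ (Metric.ball_subset_closedBall hx) _ (measurable_picardLimit α p _) ih)
    rw [ENNReal.ofReal_rpow_of_pos (by positivity), ← ENNReal.ofReal_mul (by positivity),
      ← ENNReal.ofReal_mul (Real.rpow_nonneg (sub_pos.2 levelTime_lt).le _)]
    exact ENNReal.ofReal_le_ofReal (mul_growthRatio_pow_succ_le ballBound_pos hA hp hlarge
      (rpow_mul_half_pow_le_rpow_sub_levelTime (Ioo_subset_Icc_self hα) hT.le ht.1.le))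

lemma slab_prod_ball_pos (hT : 0 < T) (hr : 0 < r) (c : Space N) :
    0 < slab N T (Ioc (T / 2) T ×ˢ Metric.ball c r) := by
  rw [slab, Measure.prod_prod, Measure.restrict_apply measurableSet_Ioc,
    inter_eq_left.2 (Ioc_subset_Ioc_left (by linarith)), Real.volume_Ioc]
  exact ENNReal.mul_pos (ENNReal.ofReal_pos.2 (by linarith)).ne'
    (Metric.measure_ball_pos _ _ hr).ne'

lemma rpow_mul_rpow_le_blowupConst (hα : α ∈ Ioo (0 : ℝ) 1) (hp : 1 < p) (hr : 0 < r) (hT : 0 < T)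
    (hTr : T ^ α ≤ r ^ 2) (hA : 0 < A) (hf : Measurable f)
    (hfA : ∀ y ∈ Metric.ball c r, ENNReal.ofReal A ≤ f y)
    (hfin : ∀ᵐ z ∂(slab N T), picardLimit α p (volume.withDensity f) z.1 z.2 < ∞) :
    T ^ α * A ^ (p - 1) ≤ blowupConst N p := by
  by_contra! hlarge
  have tendsto_top : Tendsto (fun n : ℕ => ENNReal.ofReal (ballBound N * A * growthRatio p ^ n))
      atTop (𝓝 ∞) :=
    ENNReal.tendsto_ofReal_atTop.comp <| (tendsto_pow_atTop_atTop_of_one_lt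
      (one_lt_growthRatio hp)).const_mul_atTop (mul_pos (ballBound_pos N) hA)
  have not_lt_top : ∀ z ∈ Ioc (T / 2) T ×ˢ Metric.ball c r,
      ¬ picardLimit α p (volume.withDensity f) z.1 z.2 < ∞ := by
    rintro ⟨t, x⟩ ⟨ht, hx⟩
    exact not_lt.2 <| le_of_tendsto' tendsto_top fun n =>
      ballBound_mul_growthRatio_pow_le_picardLimit hα hp hr hT hTr hA hf hfA hlarge.le n t
        ⟨(levelTime_le_half hT.le n).trans_lt ht.1, ht.2⟩ x hx
  exact (slab_prod_ball_pos hT hr c).ne' (measure_mono_null not_lt_top hfin)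

lemma min_rpow_sq_mul_rpow_le_blowupConst (hα : α ∈ Ioo (0 : ℝ) 1) (hp : 1 < p) (hr : 0 < r)
    (hT : 0 < T) (hA : 0 < A) (hf : Measurable f)
    (hfA : ∀ y ∈ Metric.ball c r, ENNReal.ofReal A ≤ f y)
    (hfin : ∀ᵐ z ∂(slab N T), picardLimit α p (volume.withDensity f) z.1 z.2 < ∞) :
    min (T ^ α) (r ^ 2) * A ^ (p - 1) ≤ blowupConst N p := by
  rcases le_total (T ^ α) (r ^ 2) with short | long
  · rw [min_eq_left short]
    exact rpow_mul_rpow_le_blowupConst hα hp hr hT short hA hf hfA hfin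
  · have sq_rpow : ((r ^ 2) ^ α⁻¹) ^ α = r ^ 2 := Real.rpow_inv_rpow (by positivity) hα.1.ne'
    have sq_rpow_le : (r ^ 2) ^ α⁻¹ ≤ T := by
      rwa [← Real.rpow_le_rpow_iff (by positivity) hT.le hα.1, sq_rpow]
    rw [min_eq_right long, ← sq_rpow]
    exact rpow_mul_rpow_le_blowupConst hα hp hr (by positivity) sq_rpow.le hA hf hfA
      (ae_mono (slab_mono sq_rpow_le) hfin)

end Necessary

/-! ### Local solvability for bounded data -/

section Bounded

variable {α p t T A : ℝ} {f : Space N → ℝ≥0∞}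

lemma opP_le_of_le (hα : α ∈ Ioo (0 : ℝ) 1) (ht : 0 < t) (hf : Measurable f) {a : ℝ≥0∞}
    (h : ∀ y, f y ≤ a) (x : Space N) : opP α t (volume.withDensity f) x ≤ a := by
  calc opP α t (volume.withDensity f) x ≤ ∫⁻ θ in Ioi 0, mittagDensity α θ * a :=
        setLIntegral_mono' measurableSet_Ioi fun θ hθ => mul_le_mul_right
          (heat_le_of_le (mul_pos (Real.rpow_pos_of_pos ht α) hθ) hf h x) _
    _ = a := by
        rw [lintegral_mul_const _ (measurable_mittagDensity α), lintegral_mittagDensity hα, one_mul]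

lemma opS_le_of_le (hα : α ∈ Ioo (0 : ℝ) 1) (ht : 0 < t) (hf : Measurable f) {a : ℝ≥0∞}
    (h : ∀ y, f y ≤ a) (x : Space N) : opS α t (volume.withDensity f) x ≤ 4 * a := by
  calc opS α t (volume.withDensity f) x
      ≤ ∫⁻ θ in Ioi 0, ENNReal.ofReal θ * mittagDensity α θ * a :=
        setLIntegral_mono' measurableSet_Ioi fun θ hθ => mul_le_mul_right
          (heat_le_of_le (mul_pos (Real.rpow_pos_of_pos ht α) hθ) hf h x) _
    _ = (∫⁻ θ in Ioi 0, ENNReal.ofReal θ * mittagDensity α θ) * a :=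
        lintegral_mul_const _ (ENNReal.measurable_ofReal.mul (measurable_mittagDensity α))
    _ ≤ 4 * a := mul_le_mul_left (lintegral_mul_mittagDensity_le hα) _

lemma duhamel_le_of_le (hα : α ∈ Ioo (0 : ℝ) 1) (hp : 0 ≤ p) (ht : 0 < t) (hf : Measurable f)
    {a b : ℝ≥0∞} (hfa : ∀ y, f y ≤ a) {u : ℝ → Space N → ℝ≥0∞}
    (hu : Measurable (Function.uncurry u)) (hub : ∀ s ∈ Ioo 0 t, ∀ y, u s y ≤ b) (x : Space N) :
    duhamel α p (volume.withDensity f) u t x ≤ a + ENNReal.ofReal (t ^ α) * (4 * b ^ p) := by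
  calc duhamel α p (volume.withDensity f) u t x
      ≤ a + ENNReal.ofReal α * ∫⁻ s in Ioo 0 t,
          ENNReal.ofReal ((t - s) ^ (α - 1)) * (4 * b ^ p) :=
        add_le_add (opP_le_of_le hα ht hf hfa x)
          (mul_le_mul_right (setLIntegral_mono' measurableSet_Ioo fun s hs =>
            mul_le_mul_right (opS_le_of_le hα (sub_pos.2 hs.2)
              ((hu.comp measurable_prodMk_left).pow_const p)
              (fun y => ENNReal.rpow_le_rpow (hub s hs y) hp) x) _) _)
    _ = a + ENNReal.ofReal (t ^ α) * (4 * b ^ p) := by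
        rw [lintegral_mul_const _ (by fun_prop), ← mul_assoc,
          ofReal_mul_lintegral_sub_rpow hα.1 ht.le, sub_zero]

lemma picard_le_two_mul (hα : α ∈ Ioo (0 : ℝ) 1) (hp : 0 ≤ p) (hA : 0 < A)
    (hTA : T ^ α * (4 * (2 * A) ^ p) ≤ A) (hf : Measurable f)
    (hfA : ∀ y, f y ≤ ENNReal.ofReal A) (n : ℕ) :
    ∀ t ∈ Ioc 0 T, ∀ x, picard α p (volume.withDensity f) n t x ≤ ENNReal.ofReal (2 * A) := by
  induction n with
  | zero => exact fun _ _ _ => zero_le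
  | succ n ih =>
    intro t ht x
    have t_rpow_le : t ^ α * (4 * (2 * A) ^ p) ≤ A :=
      (mul_le_mul_of_nonneg_right (Real.rpow_le_rpow ht.1.le ht.2 hα.1.le)
        (by positivity)).trans hTA
    have t_rpow_nonneg : 0 ≤ t ^ α := Real.rpow_nonneg ht.1.le α
    calc picard α p (volume.withDensity f) (n + 1) t x
        ≤ ENNReal.ofReal A + ENNReal.ofReal (t ^ α) * (4 * ENNReal.ofReal (2 * A) ^ p) :=
          duhamel_le_of_le hα hp ht.1 hf hfA (measurable_picard α p _ n)
            (fun s hs => ih s ⟨hs.1, hs.2.le.trans ht.2⟩) x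
      _ = ENNReal.ofReal (A + t ^ α * (4 * (2 * A) ^ p)) := by
          rw [ENNReal.ofReal_rpow_of_pos (by positivity),
            show (4 : ℝ≥0∞) = ENNReal.ofReal 4 by norm_num, ← ENNReal.ofReal_mul (by norm_num),
            ← ENNReal.ofReal_mul t_rpow_nonneg, ← ENNReal.ofReal_add hA.le (by positivity)]
      _ ≤ ENNReal.ofReal (2 * A) := ENNReal.ofReal_le_ofReal (by linarith)

lemma ofReal_le_lifespan_of_le (hα : α ∈ Ioo (0 : ℝ) 1) (hp : 0 < p) (hA : 0 < A) (hT : 0 < T)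
    (hTA : T ^ α * (4 * (2 * A) ^ p) ≤ A) (hf : Measurable f)
    (hfA : ∀ y, f y ≤ ENNReal.ofReal A) :
    ENNReal.ofReal T ≤ lifespan α p (volume.withDensity f) := by
  refine ofReal_le_lifespan hp hT ?_
  filter_upwards [ae_slab_mem_Ioc T] with z hz
  exact (iSup_le fun n => picard_le_two_mul hα hp.le hA hTA hf hfA n z.1 hz z.2).trans_lt
    ENNReal.ofReal_lt_top

end Bounded

/-! ### The data `κ ψ_j` -/

lemma radius_pos {j : ℕ} (hj : 1 ≤ j) : 0 < radius N j := by
  have hj0 : (0 : ℝ) < j := by exact_mod_cast hj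
  exact Real.rpow_pos_of_pos (mul_pos hj0 (unitBallVolume_pos N)) _

lemma radius_sq (N j : ℕ) :
    radius N j ^ 2 = (j : ℝ) ^ (-(2 / (N : ℝ))) * unitBallVolume N ^ (-(2 / (N : ℝ))) := by
  have hω := (unitBallVolume_pos N).le
  unfold radius
  rw [← Real.mul_rpow j.cast_nonneg hω, ← Real.rpow_natCast, ← Real.rpow_mul (by positivity)]
  congr 1
  push_cast
  ring

lemma volume_ball_radius (hN : 1 ≤ N) {j : ℕ} (hj : 1 ≤ j) (x : Space N) :
    volume (Metric.ball x (radius N j)) = ENNReal.ofReal (j : ℝ)⁻¹ := by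
  have hN0 : (N : ℝ) ≠ 0 := by exact_mod_cast (by omega : N ≠ 0)
  have hω := unitBallVolume_pos N
  rw [volume_ball_eq x (radius_pos hj), radius, ← Real.rpow_natCast,
    ← Real.rpow_mul (by positivity), neg_mul, one_div_mul_cancel hN0, Real.rpow_neg_one, mul_inv,
    mul_assoc, inv_mul_cancel₀ hω.ne', mul_one]

/-- The function `κ ψ_j`, with values in `ℝ≥0∞`. -/
noncomputable def datumDensity (N : ℕ) (κ : ℝ) (j : ℕ) (x : Space N) : ℝ≥0∞ :=
  ENNReal.ofReal (κ * psi N j x)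

lemma datum_eq_withDensity (κ : ℝ) (j : ℕ) :
    datum N κ j = volume.withDensity (datumDensity N κ j) := rfl

instance (κ : ℝ) (j : ℕ) : SFinite (datum N κ j) := by
  rw [datum_eq_withDensity]
  infer_instance

lemma datumDensity_eq_indicator (κ : ℝ) (j : ℕ) : datumDensity N κ j =
    (Metric.ball (0 : Space N) (radius N j)).indicator fun _ => ENNReal.ofReal (κ * j) := by
  funext x
  by_cases hx : x ∈ Metric.ball (0 : Space N) (radius N j)
  · simp only [datumDensity, psi, indicator_of_mem hx]
  · simp only [datumDensity, psi, indicator_of_notMem hx, mul_zero, ENNReal.ofReal_zero]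

lemma measurable_datumDensity (κ : ℝ) (j : ℕ) : Measurable (datumDensity N κ j) := by
  rw [datumDensity_eq_indicator]
  exact measurable_const.indicator measurableSet_ball

lemma datumDensity_le (κ : ℝ) (j : ℕ) (x : Space N) :
    datumDensity N κ j x ≤ ENNReal.ofReal (κ * j) := by
  rw [datumDensity_eq_indicator]
  exact indicator_le_self _ _ x

lemma le_datumDensity (κ : ℝ) {j : ℕ} {x : Space N} (hx : x ∈ Metric.ball 0 (radius N j)) :
    ENNReal.ofReal (κ * j) ≤ datumDensity N κ j x := by
  rw [datumDensity_eq_indicator, indicator_of_mem hx]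

lemma lintegral_datumDensity_rpow (hN : 1 ≤ N) (κ : ℝ) {q : ℝ} (hq : 0 < q) {j : ℕ} (hj : 1 ≤ j) :
    ∫⁻ x, datumDensity N κ j x ^ q = ENNReal.ofReal (κ * j) ^ q * ENNReal.ofReal (j : ℝ)⁻¹ := by
  have rpow_indicator : (fun x => datumDensity N κ j x ^ q) =
      (Metric.ball (0 : Space N) (radius N j)).indicator
        fun _ => ENNReal.ofReal (κ * j) ^ q := by
    rw [datumDensity_eq_indicator]
    exact (indicator_comp_of_zero (g := fun y : ℝ≥0∞ => y ^ q)
      (ENNReal.zero_rpow_of_pos hq)).symm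
  rw [rpow_indicator, lintegral_indicator_const measurableSet_ball, volume_ball_radius hN hj]

lemma datum_mono {κ κ' : ℝ} (h : κ ≤ κ') (j : ℕ) : datum N κ j ≤ datum N κ' j :=
  withDensity_mono <| ae_of_all _ fun x => ENNReal.ofReal_le_ofReal <|
    mul_le_mul_of_nonneg_right h <| indicator_nonneg (fun _ _ => j.cast_nonneg) x

/-! ### The global existence threshold -/

lemma exists_hasGlobalSolution_datum (hN : 1 ≤ N) {p : ℝ} (hp : fujitaExponent N < p) :
    ∃ ε : ℝ, 0 < ε ∧ ∀ α ∈ Ioo (0 : ℝ) 1, ∀ j : ℕ, 1 ≤ j →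
      HasGlobalSolution α p (datum N (ε * (j : ℝ) ^ (2 / ((N : ℝ) * (p - 1)) - 1)) j) := by
  obtain ⟨ε, hε, hasGlobalSolution_of_small⟩ := exists_hasGlobalSolution_of_small hN hp
  refine ⟨ε, hε, fun α hα j hj => ?_⟩
  rw [datum_eq_withDensity]
  refine hasGlobalSolution_of_small α hα _ (measurable_datumDensity _ j) (le_of_eq ?_)
  have hj0 : (0 : ℝ) < j := by exact_mod_cast hj
  have hq : 0 < criticalExponent N p := one_pos.trans (one_lt_criticalExponent hN hp)
  have amplitude : ε * (j : ℝ) ^ (2 / ((N : ℝ) * (p - 1)) - 1) * j =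
      ε * (j : ℝ) ^ (criticalExponent N p)⁻¹ := by
    rw [mul_assoc, ← Real.rpow_add_one hj0.ne', sub_add_cancel, criticalExponent, inv_div]
  rw [lintegral_datumDensity_rpow hN _ hq hj, amplitude,
    ENNReal.ofReal_rpow_of_pos (by positivity), ENNReal.ofReal_rpow_of_pos hε,
    ← ENNReal.ofReal_mul (by positivity), Real.mul_rpow hε.le (by positivity),
    Real.rpow_inv_rpow hj0.le hq.ne', mul_assoc, mul_inv_cancel₀ hj0.ne', mul_one]

lemma min_rpow_radius_sq_mul_rpow_le_blowupConst {α p T κ : ℝ} (hα : α ∈ Ioo (0 : ℝ) 1)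
    (hp : 1 < p) (hT : 0 < T) (hκ : 0 < κ) {j : ℕ} (hj : 1 ≤ j)
    (hfin : ∀ᵐ z ∂slab N T, picardLimit α p (datum N κ j) z.1 z.2 < ∞) :
    min (T ^ α) (radius N j ^ 2) * (κ * j) ^ (p - 1) ≤ blowupConst N p :=
  min_rpow_sq_mul_rpow_le_blowupConst hα hp (radius_pos hj) hT
    (mul_pos hκ (by exact_mod_cast hj)) (measurable_datumDensity κ j)
    (fun _ hy => le_datumDensity κ hy) hfin

/-- The constant in the upper bound for the global existence threshold of `κ ψ_j`. -/
noncomputable def thresholdConst (N : ℕ) (p : ℝ) : ℝ :=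
  (blowupConst N p * unitBallVolume N ^ (2 / (N : ℝ))) ^ (p - 1)⁻¹

lemma thresholdConst_pos (N : ℕ) (p : ℝ) : 0 < thresholdConst N p := by
  have hC := blowupConst_pos N p
  have hω := unitBallVolume_pos N
  unfold thresholdConst
  positivity

lemma le_of_hasGlobalSolution_datum {α p κ : ℝ} (hα : α ∈ Ioo (0 : ℝ) 1) (hp : 1 < p)
    (hκ : 0 < κ) {j : ℕ} (hj : 1 ≤ j) (h : HasGlobalSolution α p (datum N κ j)) :
    κ ≤ thresholdConst N p * (j : ℝ) ^ (2 / ((N : ℝ) * (p - 1)) - 1) := by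
  have hj0 : (0 : ℝ) < j := by exact_mod_cast hj
  have hω := unitBallVolume_pos N
  have hC := blowupConst_pos N p
  have hr := radius_pos (N := N) hj
  have hT : 0 < (radius N j ^ 2) ^ α⁻¹ := by positivity
  have radius_sq_mul_le := min_rpow_radius_sq_mul_rpow_le_blowupConst hα hp hT hκ hj
    ((hasGlobalSolution_iff_picardLimit_lt_top (by linarith)).1 h _ hT)
  rw [Real.rpow_inv_rpow (by positivity) hα.1.ne', min_self, radius_sq, Real.rpow_neg hj0.le,
    Real.rpow_neg hω.le, ← mul_inv, inv_mul_le_iff₀ (by positivity),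
    ← Real.le_rpow_inv_iff_of_pos (by positivity) (by positivity) (sub_pos.2 hp)]
    at radius_sq_mul_le
  rw [Real.rpow_sub_one hj0.ne', ← mul_div_assoc, le_div_iff₀ hj0]
  refine radius_sq_mul_le.trans_eq ?_
  rw [thresholdConst, mul_assoc, Real.mul_rpow (by positivity) (by positivity),
    ← Real.rpow_mul hj0.le, mul_comm, mul_comm (unitBallVolume N ^ _), ← div_eq_mul_inv, div_div]

/-- The amplitudes `κ > 0` for which the datum `κ ψ_j` has a global-in-time solution. -/
def globalAmplitudes (N : ℕ) (p α : ℝ) (j : ℕ) : Set ℝ :=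
  {κ | 0 < κ ∧ HasGlobalSolution α p (datum N κ j)}

/-- The threshold `κ₂(α, j)` between global existence and nonexistence for the data `κ ψ_j`. -/
noncomputable def globalThreshold (N : ℕ) (p α : ℝ) (j : ℕ) : ℝ :=
  sSup (globalAmplitudes N p α j)

lemma mem_upperBounds_globalAmplitudes {α p : ℝ} (hα : α ∈ Ioo (0 : ℝ) 1) (hp : 1 < p) {j : ℕ}
    (hj : 1 ≤ j) : thresholdConst N p * (j : ℝ) ^ (2 / ((N : ℝ) * (p - 1)) - 1) ∈
      upperBounds (globalAmplitudes N p α j) :=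
  fun _ hκ => le_of_hasGlobalSolution_datum hα hp hκ.1 hj hκ.2

lemma globalThreshold_le {α p : ℝ} (hα : α ∈ Ioo (0 : ℝ) 1) (hp : 1 < p) {j : ℕ} (hj : 1 ≤ j) :
    globalThreshold N p α j ≤ thresholdConst N p * (j : ℝ) ^ (2 / ((N : ℝ) * (p - 1)) - 1) :=
  Real.sSup_le (mem_upperBounds_globalAmplitudes hα hp hj) <|
    mul_nonneg (thresholdConst_pos N p).le (Real.rpow_nonneg j.cast_nonneg _)

lemma exists_mul_rpow_le_globalThreshold (hN : 1 ≤ N) {p : ℝ} (hp : fujitaExponent N < p) :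
    ∃ ε : ℝ, 0 < ε ∧ ∀ α ∈ Ioo (0 : ℝ) 1, ∀ j : ℕ, 1 ≤ j →
      ε * (j : ℝ) ^ (2 / ((N : ℝ) * (p - 1)) - 1) ≤ globalThreshold N p α j := by
  obtain ⟨ε, hε, hasGlobalSolution⟩ := exists_hasGlobalSolution_datum hN hp
  refine ⟨ε, hε, fun α hα j hj => le_csSup ⟨_, mem_upperBounds_globalAmplitudes hα
    (one_lt_of_fujitaExponent_lt hp) hj⟩ ⟨?_, hasGlobalSolution α hα j hj⟩⟩
  exact mul_pos hε (Real.rpow_pos_of_pos (by exact_mod_cast hj) _)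

lemma hasGlobalSolution_of_lt_globalThreshold {α p κ : ℝ} (hp : 0 < p) (hκ : 0 < κ) {j : ℕ}
    (h : κ < globalThreshold N p α j) : HasGlobalSolution α p (datum N κ j) := by
  have nonempty : (globalAmplitudes N p α j).Nonempty := by
    rw [nonempty_iff_ne_empty]
    intro empty
    rw [globalThreshold, empty, Real.sSup_empty] at h
    exact hκ.not_gt h
  obtain ⟨κ', ⟨-, hκ'⟩, hlt⟩ := exists_lt_of_lt_csSup nonempty h
  exact hκ'.mono hp (datum_mono hlt.le j)

lemma not_hasGlobalSolution_of_globalThreshold_lt {α p κ : ℝ} (hα : α ∈ Ioo (0 : ℝ) 1)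
    (hp : 1 < p) (hκ : 0 < κ) {j : ℕ} (hj : 1 ≤ j) (h : globalThreshold N p α j < κ) :
    ¬HasGlobalSolution α p (datum N κ j) := fun hglob =>
  h.not_ge <| le_csSup ⟨_, mem_upperBounds_globalAmplitudes hα hp hj⟩ ⟨hκ, hglob⟩

lemma limsup_ofReal_mem_Ioo {c : ℝ} (hc : 0 < c) {l : Filter ℝ} [l.NeBot] {f : ℝ → ℝ}
    (hf : Tendsto f l (𝓝 c)) :
    limsup (fun α => ENNReal.ofReal (f α)) l ∈ Ioo (0 : ℝ≥0∞) ∞ := by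
  rw [(ENNReal.tendsto_ofReal hf).limsup_eq]
  exact ⟨ENNReal.ofReal_pos.2 hc, ENNReal.ofReal_lt_top⟩

theorem exists_globalThreshold_simeqOn (hN : 1 ≤ N) {p : ℝ} (hp : fujitaExponent N < p) :
    ∃ κ₂ : ℝ → ℕ → ℝ,
      (∀ α ∈ Ioo (0 : ℝ) 1, ∀ j : ℕ, 1 ≤ j →
        0 < κ₂ α j ∧
        (∀ κ : ℝ, 0 < κ → κ < κ₂ α j → HasGlobalSolution α p (datum N κ j)) ∧
        (∀ κ : ℝ, κ₂ α j < κ → ¬HasGlobalSolution α p (datum N κ j))) ∧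
      SimeqOn (fun _ => {j : ℕ | 1 ≤ j})
        (fun α j => ENNReal.ofReal (κ₂ α j))
        (fun _ j => ENNReal.ofReal ((j : ℝ) ^ (2 / ((N : ℝ) * (p - 1)) - 1))) := by
  have hp1 := one_lt_of_fujitaExponent_lt hp
  have hK := thresholdConst_pos N p
  obtain ⟨ε, hε, le_threshold⟩ := exists_mul_rpow_le_globalThreshold hN hp
  refine ⟨globalThreshold N p, fun α hα j hj => ?_, fun _ => ε, fun _ => thresholdConst N p,
    fun α hα => ⟨hε, hK, fun j hj => ?_⟩,
    limsup_ofReal_mem_Ioo hε tendsto_const_nhds, limsup_ofReal_mem_Ioo hK tendsto_const_nhds⟩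
  · have threshold_pos : 0 < globalThreshold N p α j :=
      (mul_pos hε (Real.rpow_pos_of_pos (by exact_mod_cast hj) _)).trans_le (le_threshold α hα j hj)
    exact ⟨threshold_pos,
      fun κ hκ => hasGlobalSolution_of_lt_globalThreshold (one_pos.trans hp1) hκ,
      fun κ hlt => not_hasGlobalSolution_of_globalThreshold_lt hα hp1
        (threshold_pos.trans hlt) hj hlt⟩
  · rw [← ENNReal.ofReal_mul hε.le, ← ENNReal.ofReal_mul hK.le]
    exact ⟨ENNReal.ofReal_le_ofReal (le_threshold α hα j hj),
      ENNReal.ofReal_le_ofReal (globalThreshold_le hα hp1 hj)⟩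

/-! ### The life span of `κ ψ_j` -/

lemma lifespan_datum_le {α p κ : ℝ} (hα : α ∈ Ioo (0 : ℝ) 1) (hp : 1 < p) (hκ : 0 < κ) {j : ℕ}
    (hj : 1 ≤ j) (h : blowupConst N p * (κ * j) ^ (-(p - 1)) < radius N j ^ 2) :
    lifespan α p (datum N κ j) ≤
      ENNReal.ofReal (blowupConst N p ^ (1 / α) * (κ * j) ^ (-((p - 1) / α))) := by
  have hA : 0 < κ * j := mul_pos hκ (by exact_mod_cast hj)
  have hC := blowupConst_pos N p
  have bound_eq : blowupConst N p ^ (1 / α) * (κ * j) ^ (-((p - 1) / α)) =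
      (blowupConst N p * (κ * j) ^ (-(p - 1))) ^ α⁻¹ := by
    rw [Real.mul_rpow hC.le (by positivity), ← Real.rpow_mul hA.le, one_div, neg_mul,
      div_eq_mul_inv]
  rw [bound_eq]
  by_contra! hlt
  obtain ⟨T, hT, bound_lt_T, hfin⟩ :=
    exists_picardLimit_lt_top_of_lt_lifespan (one_pos.trans hp).le hlt
  rw [ENNReal.ofReal_lt_ofReal_iff hT,
    Real.rpow_inv_lt_iff_of_pos (by positivity) hT.le hα.1] at bound_lt_T
  have const_lt := lt_min bound_lt_T h
  rw [Real.rpow_neg hA.le, ← div_eq_mul_inv, div_lt_iff₀ (by positivity)] at const_lt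
  exact const_lt.not_ge (min_rpow_radius_sq_mul_rpow_le_blowupConst hα hp hT hκ hj hfin)

lemma min_lifespan_radius_le {α p κ : ℝ} (hα : α ∈ Ioo (0 : ℝ) 1) (hp : 1 < p) (hκ : 0 < κ)
    {j : ℕ} (hj : 1 ≤ j) :
    min (lifespan α p (datum N κ j) ^ (α / 2)) (ENNReal.ofReal (radius N j)) ≤
      ENNReal.ofReal (Real.sqrt (blowupConst N p) * (κ * j) ^ (-((p - 1) / 2))) := by
  have hA : 0 < κ * j := mul_pos hκ (by exact_mod_cast hj)
  have hC := blowupConst_pos N p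
  have hα0 := hα.1
  rcases lt_or_ge (blowupConst N p * (κ * j) ^ (-(p - 1))) (radius N j ^ 2) with h | h
  · refine (min_le_left _ _).trans ?_
    refine (ENNReal.rpow_le_rpow (lifespan_datum_le hα hp hκ hj h) (by positivity)).trans_eq ?_
    rw [ENNReal.ofReal_rpow_of_pos (by positivity), Real.mul_rpow (by positivity) (by positivity),
      ← Real.rpow_mul hC.le, ← Real.rpow_mul hA.le, Real.sqrt_eq_rpow]
    congr 3 <;> field_simp
  · refine (min_le_right _ _).trans (ENNReal.ofReal_le_ofReal ?_)
    have bound_sq : (Real.sqrt (blowupConst N p) * (κ * j) ^ (-((p - 1) / 2))) ^ 2 =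
        blowupConst N p * (κ * j) ^ (-(p - 1)) := by
      rw [mul_pow, Real.sq_sqrt hC.le, ← Real.rpow_mul_natCast hA.le, Nat.cast_ofNat, neg_mul,
        div_mul_cancel₀ _ two_ne_zero]
    rw [← bound_sq] at h
    exact le_of_sq_le_sq h (by positivity)

lemma two_div_lt_sub_one_of_fujitaExponent_lt {p : ℝ} (hp : fujitaExponent N < p) :
    2 / (N : ℝ) < p - 1 := by
  unfold fujitaExponent at hp
  linarith

lemma eventually_lt_radius_sq {p κ : ℝ} (hp : fujitaExponent N < p) (hκ : 0 < κ) :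
    ∀ᶠ j : ℕ in atTop, blowupConst N p * (κ * j) ^ (-(p - 1)) < radius N j ^ 2 := by
  have gap_pos := sub_pos.2 (two_div_lt_sub_one_of_fujitaExponent_lt hp)
  have tendsto_zero : Tendsto (fun j : ℕ => blowupConst N p * κ ^ (-(p - 1)) *
      (j : ℝ) ^ (-(p - 1 - 2 / (N : ℝ)))) atTop (𝓝 0) := by
    simpa only [mul_zero, Function.comp_def] using ((tendsto_rpow_neg_atTop gap_pos).comp
      tendsto_natCast_atTop_atTop).const_mul (blowupConst N p * κ ^ (-(p - 1)))
  have volume_rpow_pos := Real.rpow_pos_of_pos (unitBallVolume_pos N) (-(2 / (N : ℝ)))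
  filter_upwards [tendsto_zero.eventually_lt_const volume_rpow_pos, eventually_ge_atTop 1]
    with j hlt hj
  have hj0 : (0 : ℝ) < j := by exact_mod_cast hj
  calc blowupConst N p * (κ * j) ^ (-(p - 1))
      = (j : ℝ) ^ (-(2 / (N : ℝ))) * (blowupConst N p * κ ^ (-(p - 1)) *
          (j : ℝ) ^ (-(p - 1 - 2 / (N : ℝ)))) := by
        rw [Real.mul_rpow hκ.le hj0.le,
          show -(p - 1) = -(2 / (N : ℝ)) + -(p - 1 - 2 / (N : ℝ)) by ring, Real.rpow_add hj0]
        ring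
    _ < (j : ℝ) ^ (-(2 / (N : ℝ))) * unitBallVolume N ^ (-(2 / (N : ℝ))) :=
        mul_lt_mul_of_pos_left hlt (Real.rpow_pos_of_pos hj0 _)
    _ = radius N j ^ 2 := (radius_sq N j).symm

lemma le_lifespan_datum {α p κ : ℝ} (hα : α ∈ Ioo (0 : ℝ) 1) (hp : 0 < p) (hκ : 0 < κ) {j : ℕ}
    (hj : 1 ≤ j) :
    ENNReal.ofReal (((4 * 2 ^ p : ℝ)⁻¹) ^ (1 / α) * (κ * j) ^ (-((p - 1) / α))) ≤
      lifespan α p (datum N κ j) := by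
  have hA : 0 < κ * j := mul_pos hκ (by exact_mod_cast hj)
  have hα0 := hα.1
  refine ofReal_le_lifespan_of_le hα hp hA (by positivity) (le_of_eq ?_)
    (measurable_datumDensity κ j) (datumDensity_le κ j)
  rw [Real.mul_rpow (by positivity) (by positivity), ← Real.rpow_mul (by positivity),
    ← Real.rpow_mul hA.le, one_div_mul_cancel hα0.ne', Real.rpow_one, neg_mul,
    div_mul_cancel₀ _ hα0.ne', Real.mul_rpow zero_le_two hA.le, neg_sub, Real.rpow_sub hA,
    Real.rpow_one]
  field_simp

lemma tendsto_lifespan_datum {α p κ : ℝ} (hα : α ∈ Ioo (0 : ℝ) 1) (hp : fujitaExponent N < p)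
    (hκ : 0 < κ) : Tendsto (fun j : ℕ => lifespan α p (datum N κ j)) atTop (𝓝 0) := by
  have hp1 := one_lt_of_fujitaExponent_lt hp
  have tendsto_bound : Tendsto (fun j : ℕ => ENNReal.ofReal
      (blowupConst N p ^ (1 / α) * (κ * j) ^ (-((p - 1) / α)))) atTop (𝓝 0) := by
    simpa only [mul_zero, ENNReal.ofReal_zero, Function.comp_def] using ENNReal.tendsto_ofReal
      (((tendsto_rpow_neg_atTop (div_pos (sub_pos.2 hp1) hα.1)).comp
        (tendsto_natCast_atTop_atTop.const_mul_atTop hκ)).const_mul (blowupConst N p ^ (1 / α)))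
  refine tendsto_of_tendsto_of_tendsto_of_le_of_le' tendsto_const_nhds tendsto_bound
    (Eventually.of_forall fun _ => zero_le) ?_
  filter_upwards [eventually_lt_radius_sq hp hκ, eventually_ge_atTop 1] with j hlt hj
  exact lifespan_datum_le hα hp1 hκ hj hlt

lemma tendsto_rpow_one_div {c : ℝ} (hc : 0 < c) :
    Tendsto (fun α : ℝ => c ^ (1 / α)) (𝓝[<] (1 : ℝ)) (𝓝 c) := by
  have continuousAt_one : ContinuousAt (fun α : ℝ => c ^ (1 / α)) 1 :=
    continuousAt_const.rpow (continuousAt_const.div continuousAt_id one_ne_zero) (Or.inl hc.ne')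
  simpa only [div_one, Real.rpow_one] using continuousAt_one.tendsto.mono_left nhdsWithin_le_nhds

theorem exists_lifespan_simeqOn {p : ℝ} (hp : fujitaExponent N < p) :
    ∃ j₀ : ℝ → ℝ → ℕ,
      SimeqOn
        (fun α => {x : ℝ × ℕ | 0 < x.1 ∧ 1 ≤ x.2 ∧ j₀ α x.1 ≤ x.2})
        (fun α x => lifespan α p (datum N x.1 x.2))
        (fun α x => ENNReal.ofReal ((x.1 * (x.2 : ℝ)) ^ (-((p - 1) / α)))) := by
  have hp1 := one_lt_of_fujitaExponent_lt hp
  have hC := blowupConst_pos N p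
  have hc : 0 < (4 * 2 ^ p : ℝ)⁻¹ := by positivity
  have exists_index : ∀ κ : ℝ, 0 < κ → ∃ J : ℕ, ∀ j : ℕ, J ≤ j →
      blowupConst N p * (κ * j) ^ (-(p - 1)) < radius N j ^ 2 := fun κ hκ =>
    eventually_atTop.1 (eventually_lt_radius_sq hp hκ)
  choose! J lt_radius_sq using exists_index
  refine ⟨fun _ => J, fun α => ((4 * 2 ^ p : ℝ)⁻¹) ^ (1 / α), fun α => blowupConst N p ^ (1 / α),
    fun α hα => ⟨by positivity, by positivity, fun x ⟨hκ, hj, hJ⟩ => ?_⟩,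
    limsup_ofReal_mem_Ioo hc (tendsto_rpow_one_div hc),
    limsup_ofReal_mem_Ioo hC (tendsto_rpow_one_div hC)⟩
  rw [← ENNReal.ofReal_mul (by positivity), ← ENNReal.ofReal_mul (by positivity)]
  exact ⟨le_lifespan_datum hα (one_pos.trans hp1) hκ hj,
    lifespan_datum_le hα hp1 hκ hj (lt_radius_sq x.1 hκ x.2 hJ)⟩

end FracFujita

theorem mainTheorem9 (N : ℕ) (hN : 1 ≤ N) (p : ℝ) (hp : FracFujita.fujitaExponent N < p) :
    (∃ κ₂ : ℝ → ℕ → ℝ,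
      (∀ α ∈ Ioo (0 : ℝ) 1, ∀ j : ℕ, 1 ≤ j →
        0 < κ₂ α j ∧
        (∀ κ : ℝ, 0 < κ → κ < κ₂ α j →
          FracFujita.HasGlobalSolution α p (FracFujita.datum N κ j)) ∧
        (∀ κ : ℝ, κ₂ α j < κ →
          ¬ FracFujita.HasGlobalSolution α p (FracFujita.datum N κ j))) ∧
      FracFujita.SimeqOn (fun _ => {j : ℕ | 1 ≤ j})
        (fun α j => ENNReal.ofReal (κ₂ α j))
        (fun _ j => ENNReal.ofReal ((j : ℝ) ^ (2 / ((N : ℝ) * (p - 1)) - 1)))) ∧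
    (∀ α ∈ Ioo (0 : ℝ) 1, ∃ C : ℝ, 0 < C ∧ ∀ κ : ℝ, 0 < κ → ∀ j : ℕ, 1 ≤ j →
      min (FracFujita.lifespan α p (FracFujita.datum N κ j) ^ (α / 2))
          (ENNReal.ofReal (FracFujita.radius N j))
        ≤ ENNReal.ofReal (C * (κ * (j : ℝ)) ^ (-((p - 1) / 2)))) ∧
    (∀ α ∈ Ioo (0 : ℝ) 1, ∀ κ : ℝ, 0 < κ →
      Tendsto (fun j : ℕ => FracFujita.lifespan α p (FracFujita.datum N κ j)) atTop (𝓝 0)) ∧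
    (∃ j₀ : ℝ → ℝ → ℕ,
      FracFujita.SimeqOn
        (fun α => {x : ℝ × ℕ | 0 < x.1 ∧ 1 ≤ x.2 ∧ j₀ α x.1 ≤ x.2})
        (fun α x => FracFujita.lifespan α p (FracFujita.datum N x.1 x.2))
        (fun α x => ENNReal.ofReal ((x.1 * (x.2 : ℝ)) ^ (-((p - 1) / α))))) := by
  have hp1 := FracFujita.one_lt_of_fujitaExponent_lt hp
  exact ⟨FracFujita.exists_globalThreshold_simeqOn hN hp,
    fun _ hα => ⟨_, Real.sqrt_pos.2 (FracFujita.blowupConst_pos N p), fun _ hκ _ hj =>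
      FracFujita.min_lifespan_radius_le hα hp1 hκ hj⟩,
    fun _ hα _ hκ => FracFujita.tendsto_lifespan_datum hα hp hκ,
    FracFujita.exists_lifespan_simeqOn hp⟩
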